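/- Let $p$ be a prime, let $\mathbb{C}_p$ be the completion of an algebraic closure of $\mathbb{Q}_p$, and put $\tilde p = p$ if $p$ is odd and $\tilde p = 4$ if $p = 2$. Let $C(\mathbb{Z}_p,\mathbb{C}_p)$ be the space of continuous functions $\mathbb{Z}_p \to \mathbb{C}_p$, and let $S$ be the $\mathbb{C}_p$-linear map on it given by $S(f)(x) = f(x) - x f(x-1)$. For $r \in \mathbb{C}_p$ with $|r-1| < 1$ let $r^x = \sum_{n\ge 0} (r-1)^n \binom{x}{n}$ for $x \in \mathbb{Z}_p$. Write $(x)_n = x(x-1)\cdots(x-n+1)$. For an integer $n \ge 1$ and real $r$ let $\Gamma(n,r) = \int_r^\infty t^{n-1} e^{-t}\,dt$. (1) The map $S$ is bijective. For $r \in \mathbb{C}_p$ with $|r-1|<1$ one may therefore define $$\overline\gamma_r : \mathbb{Z}_p \to \mathbb{C}_p,\qquad \overline\gamma_r(x) = \exp(r\tilde p)\cdot S^{-1}(y \mapsto r^y)(x-1).$$ (2) For every such $r$, the function $\overline\gamma_r$ is locally analytic (around each point of $\mathbb{Z}_p$ it is given by a convergent power series with coefficients in $\mathbb{C}_p$). The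 Mahler series of $x \mapsto \overline\gamma_r(x+1)$ is $$\overline\gamma_r(x+1) = \sum_{n=0}^\infty \left(\exp(r\tilde p)\sum_{k=0}^n \frac{n!}{k!}(r-1)^k\right)\binom{x}{n},$$ with coefficients tending to $0$, and for all $x \in \mathbb{Z}_p$ $$\overline\gamma_r(x) = \exp(r\tilde p)\sum_{n=0}^\infty (x-1)_n\, r^{x-1-n} = \exp(r\tilde p)\sum_{n=0}^\infty n!\binom{x-1}{n} r^{x-1-n},$$ where the series converge. (3) There is a unique field homomorphism $\tau_p : \mathbb{Q}(e) \to \mathbb{Q}_p$ with $\tau_p(e^{-1}) = \exp(\tilde p)$. For every integer $r \in 1 + p\mathbb{Z}$ and every integer $n \ge 1$ one has $\Gamma(n,r) \in \mathbb{Q}(e)$ and $$\overline\gamma_r(n) = \tau_p(\Gamma(n,r)),$$ and $\overline\gamma_r$ is the only continuous function $\mathbb{Z}_p \to \mathbb{C}_p$ with this interpolation property. -/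

import Mathlib

open Filter Topology MeasureTheory

noncomputable section

namespace PadicIncGamma

variable (p : ℕ) [Fact p.Prime]

/-- The inclusion of the `p`-adic integers into `ℂ_[p]`. -/
def toCp : ℤ_[p] →+* ℂ_[p] := (algebraMap ℚ_[p] ℂ_[p]).comp PadicInt.Coe.ringHom

theorem continuous_toCp : Continuous (toCp p) :=
  (continuous_algebraMap ℚ_[p] ℂ_[p]).comp continuous_subtype_val

/-- The `ℂ_[p]`-linear map `S` on continuous functions `ℤ_[p] → ℂ_[p]` given by
`S(f)(x) = f(x) - x f(x - 1)`. -/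
def S : C(ℤ_[p], ℂ_[p]) →ₗ[ℂ_[p]] C(ℤ_[p], ℂ_[p]) where
  toFun f :=
    { toFun := fun x => f x - toCp p x * f (x - 1)
      continuous_toFun := f.continuous.sub ((continuous_toCp p).mul
        (f.continuous.comp (continuous_id.sub continuous_const))) }
  map_add' f g := by
    ext x
    simp only [ContinuousMap.coe_mk, ContinuousMap.add_apply]
    ring
  map_smul' c f := by
    ext x
    simp only [ContinuousMap.coe_mk, ContinuousMap.smul_apply, smul_eq_mul, RingHom.id_apply]
    ring

/-- The inverse of `S` (meaningful because `S` is bijective, which the theorem asserts). -/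
def SInv : C(ℤ_[p], ℂ_[p]) → C(ℤ_[p], ℂ_[p]) := Function.invFun (S p)

/-- The binomial coefficient function `x ↦ (x choose n)`, with values in `ℂ_[p]`. -/
def binomFun (n : ℕ) : C(ℤ_[p], ℂ_[p]) where
  toFun x := toCp p (Ring.choose x n)
  continuous_toFun := (continuous_toCp p).comp (PadicInt.continuous_choose n)

/-- The `p`-adic power function `g_r : x ↦ r ^ x`, for `‖r - 1‖ < 1`, given by the (uniformly
convergent) binomial series `r ^ x = ∑ (r - 1) ^ n * (x choose n)`. -/
def powFun (r : ℂ_[p]) : C(ℤ_[p], ℂ_[p]) := ∑' n : ℕ, (r - 1) ^ n • binomFun p n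

theorem norm_binomFun_le (n : ℕ) : ‖binomFun p n‖ ≤ 1 := by
  refine (ContinuousMap.norm_le _ zero_le_one).2 fun x => ?_
  change ‖algebraMap ℚ_[p] ℂ_[p] ((Ring.choose x n : ℤ_[p]) : ℚ_[p])‖ ≤ 1
  rw [norm_algebraMap']
  exact PadicInt.norm_le_one _

theorem summable_powFun (r : ℂ_[p]) (hr : ‖r - 1‖ < 1) :
    Summable fun n : ℕ => (r - 1) ^ n • binomFun p n := by
  refine Summable.of_norm_bounded (summable_geometric_of_lt_one (norm_nonneg _) hr) fun n => ?_
  rw [norm_smul, norm_pow]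
  exact mul_le_of_le_one_right (by positivity) (norm_binomFun_le p n)

/-- `powFun` extends the ordinary powers with natural exponents. -/
theorem powFun_natCast (r : ℂ_[p]) (hr : ‖r - 1‖ < 1) (m : ℕ) :
    powFun p r (m : ℤ_[p]) = r ^ m := by
  rw [powFun, ← ContinuousMap.tsum_apply (summable_powFun p r hr)]
  have h : ∀ n : ℕ, ((r - 1) ^ n • binomFun p n) (m : ℤ_[p]) =
      (r - 1) ^ n * (m.choose n : ℂ_[p]) := fun n => by
    simp [binomFun, Ring.choose_natCast]
  simp_rw [h]
  rw [tsum_eq_sum (s := Finset.range (m + 1))]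
  · conv_rhs => rw [← sub_add_cancel r 1, add_pow]
    simp
  · intro n hn
    rw [Nat.choose_eq_zero_of_lt (by simpa [Nat.lt_succ_iff] using hn)]
    simp

/-- The number `p̃`: it is `p` for odd `p`, and `4` for `p = 2`. -/
def pTilde (p : ℕ) : ℕ := if p = 2 then 4 else p

/-- The function `γ̄_r(x) = exp(r p̃) * S⁻¹(g_r)(x - 1)`. -/
def gammaBar (r : ℂ_[p]) (x : ℤ_[p]) : ℂ_[p] :=
  NormedSpace.exp (r * (pTilde p : ℂ_[p])) * SInv p (powFun p r) (x - 1)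

variable {p} in
/-- Locally analytic functions `ℤ_[p] → ℂ_[p]`: around each point the function is given by a
convergent power series with coefficients in `ℂ_[p]`. -/
def IsLocallyAnalytic (f : ℤ_[p] → ℂ_[p]) : Prop :=
  ∀ x₀ : ℤ_[p], ∃ ρ : ℝ, 0 < ρ ∧ ∃ a : ℕ → ℂ_[p], ∀ x : ℤ_[p], ‖x - x₀‖ < ρ →
    HasSum (fun n => a n * toCp p (x - x₀) ^ n) (f x)

/-- The (complex) incomplete Gamma function `Γ(s, r) = ∫_r^∞ t ^ (s - 1) * exp (-t) dt`, with
real lower limit `r`. When `s` is a positive integer the integrand is entire in `t`, so that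
negative values of `r` are unproblematic. -/
def incompleteGamma (s : ℂ) (r : ℝ) : ℂ :=
  ∫ t : ℝ in Set.Ioi r, (t : ℂ) ^ (s - 1) * Complex.exp (-(t : ℂ))

/-- The field `ℚ(e)`, as a subfield of `ℂ`. -/
abbrev Qe : IntermediateField ℚ ℂ := IntermediateField.adjoin ℚ {Complex.exp 1}

/-- The number `e`, as an element of `ℚ(e)`. -/
abbrev eGen : Qe := IntermediateField.AdjoinSimple.gen ℚ (Complex.exp 1)

end PadicIncGamma

end

/-! Write `S = 1 - T` with `T f(x) = x f(x - 1)`. Then `T^n f(x) = (x)_n f(x - n)` and `(x)_n = n! *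
(x choose n)`, so `‖T^n f‖ ≤ |n!| ‖f‖`. Since `|n!|` decays geometrically, the Neumann series `∑
T^n` inverts `S`, and it is the series in falling factorials. Injectivity also follows directly: a
solution of `f(x) = x f(x - 1)` vanishes at `0`, hence on `ℕ`, which is dense.

In the Mahler basis, `T` sends `(x choose n)` to `(n + 1) (x choose (n + 1))`. Thus `S f = r^x`
becomes the recursion `c (n + 1) = (n + 1) c n + (r - 1)^(n + 1)`, whose solution decays like
`max(p^(-1/p), |r - 1|)^n`. Geometric decay of Mahler coefficients forces local analyticity: on a
disc of radius `p^(-N)` the polynomials `(x choose i)` have coefficients growing at most like `p^(i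
/ ((p - 1) p^N))`, a rate that tends to `1` as `N` grows.

At a natural number `m`, both `S⁻¹(r^x)(m)` and `e^r Γ(m + 1, r)` equal `∑ k ≤ m, m!/k! r^k`. The
interpolation property is therefore formal once `τ_p` exists, and that requires both `e` and
`exp(p̃)` to be transcendental over `ℚ`. For `e` this is Hermite's argument with simultaneous
approximations to the powers of `e` (`transcendental_exp_one`).

For `exp(p̃)` (`transcendental_exp_natCast`), interpolation determinants are used: take the
derivatives of `X^j exp(kWX)` at small natural numbers. These functions converge on a disc of radius
greater than `1`, so the determinants are `p`-adically tiny (`norm_det_expVal_le`). If `exp W` were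
algebraic, a nonzero determinant could not be that small (`exists_lower_bound`). A Wronskian zero
estimate (`eq_zero_of_vanishing`) supplies a nonzero one. -/

namespace PadicIncGamma

variable (p : ℕ) [Fact p.Prime]

/-! ### The `p`-adic size of factorials and of `p̃`. -/

/-- The real number `p ^ (1 / (p - 1))`, the inverse of the radius of convergence of the `p`-adic
exponential. -/
noncomputable def rho : ℝ := (p : ℝ) ^ (((p - 1 : ℕ) : ℝ)⁻¹)

/-- The real number `p ^ (-1 / p)`, which governs the decay of `‖n!‖`. -/
noncomputable def kappa : ℝ := ((p : ℝ)⁻¹) ^ ((p : ℝ)⁻¹)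

theorem prime_pos_real : (0 : ℝ) < p := mod_cast (Fact.out : p.Prime).pos

theorem one_lt_prime_real : (1 : ℝ) < p := mod_cast (Fact.out : p.Prime).one_lt

theorem rho_pow : rho p ^ (p - 1) = p :=
  Real.rpow_inv_natCast_pow (prime_pos_real p).le
    (Nat.sub_ne_zero_of_lt (Fact.out : p.Prime).one_lt)

theorem one_le_rho : 1 ≤ rho p :=
  Real.one_le_rpow (one_lt_prime_real p).le (by positivity)

theorem rho_pos : 0 < rho p := one_pos.trans_le (one_le_rho p)

theorem kappa_pos : 0 < kappa p := Real.rpow_pos_of_pos (inv_pos.2 (prime_pos_real p)) _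

theorem kappa_pow : kappa p ^ p = (p : ℝ)⁻¹ :=
  Real.rpow_inv_natCast_pow (inv_pos.2 (prime_pos_real p)).le (Fact.out : p.Prime).ne_zero

theorem kappa_lt_one : kappa p < 1 :=
  Real.rpow_lt_one (inv_pos.2 (prime_pos_real p)).le (inv_lt_one_of_one_lt₀ (one_lt_prime_real p))
    (inv_pos.2 (prime_pos_real p))

theorem norm_factorial (n : ℕ) :
    ‖(n.factorial : ℚ_[p])‖ = ((p : ℝ) ^ padicValNat p n.factorial)⁻¹ := by
  rw [Padic.norm_eq_zpow_neg_valuation (Nat.cast_ne_zero.2 n.factorial_ne_zero),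
    Padic.valuation_natCast, zpow_neg, zpow_natCast]

/-- Legendre's formula: `(p - 1) v_p(n!)` is `n` minus the sum of the base `p` digits of `n`, hence
at most `n`. -/
theorem inv_norm_factorial_le (n : ℕ) : ‖(n.factorial : ℚ_[p])‖⁻¹ ≤ rho p ^ n := by
  rw [norm_factorial, inv_inv]
  conv_lhs => rw [← rho_pow p]
  rw [← pow_mul, sub_one_mul_padicValNat_factorial]
  exact pow_le_pow_right₀ (one_le_rho p) (Nat.sub_le _ _)

/-- Among `1, ..., n` there are `⌊n/p⌋` multiples of `p`. The factor `p` pays for rounding down;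
only geometric decay matters later. -/
theorem norm_factorial_le (n : ℕ) : ‖(n.factorial : ℚ_[p])‖ ≤ p * kappa p ^ n := by
  have hp := (Fact.out : p.Prime)
  have hv : n / p ≤ padicValNat p n.factorial := by
    rw [padicValNat_factorial (b := Nat.log p n + 2) (by omega)]
    simpa using Finset.single_le_sum (f := fun i => n / p ^ i) (fun _ _ => Nat.zero_le _)
      (show 1 ∈ Finset.Ico 1 (Nat.log p n + 2) by simp)
  have h1 : ‖(n.factorial : ℚ_[p])‖ ≤ kappa p ^ (p * (n / p)) := by
    rw [norm_factorial, pow_mul, kappa_pow, inv_pow]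
    exact inv_anti₀ (pow_pos (prime_pos_real p) _)
      (pow_le_pow_right₀ (one_lt_prime_real p).le hv)
  have h2 : kappa p ^ (p * (n / p) + p) ≤ kappa p ^ n :=
    pow_le_pow_of_le_one (kappa_pos p).le (kappa_lt_one p).le (by
      have := Nat.div_add_mod n p
      have := Nat.mod_lt n hp.pos
      omega)
  rw [pow_add, kappa_pow, ← div_eq_mul_inv, div_le_iff₀ (prime_pos_real p)] at h2
  linarith

/-- This is why `p̃ = 4` at `p = 2`: there `rho` is `2`, so `2` itself lies on the boundary of the
disc of convergence. -/
theorem norm_pTilde_mul_rho_lt_one : ‖(pTilde p : ℚ_[p])‖ * rho p < 1 := by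
  have hp := (Fact.out : p.Prime)
  by_cases h2 : p = 2
  · subst h2
    have h : ‖((4 : ℕ) : ℚ_[2])‖ = 1 / 4 := by
      rw [show ((4 : ℕ) : ℚ_[2]) = ((2 : ℕ) : ℚ_[2]) * ((2 : ℕ) : ℚ_[2]) by norm_num, norm_mul,
        Padic.norm_p]
      norm_num
    have hr : rho 2 = 2 := by simp [rho]
    rw [pTilde, if_pos rfl, h, hr]
    norm_num
  · rw [pTilde, if_neg h2, Padic.norm_p, inv_mul_lt_iff₀ (prime_pos_real p), mul_one]
    have h3 : 1 < p - 1 := by have := hp.two_le; omega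
    have := Real.rpow_lt_rpow_of_exponent_lt (one_lt_prime_real p)
      (inv_lt_one_of_one_lt₀ (show (1 : ℝ) < ((p - 1 : ℕ) : ℝ) by exact_mod_cast h3))
    simpa [rho] using this

/-! ### The `p`-adic exponential inside its disc of convergence. -/

section Exp

variable {𝔸 : Type*} [NormedField 𝔸] [NormedAlgebra ℚ_[p] 𝔸]

theorem inv_rho_le_radius :
    ((rho p)⁻¹.toNNReal : ENNReal) ≤ (NormedSpace.expSeries ℚ_[p] 𝔸).radius := by
  refine FormalMultilinearSeries.le_radius_of_bound _ 1 fun n => ?_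
  rw [NormedSpace.expSeries, Real.coe_toNNReal _ (inv_nonneg.2 (rho_pos p).le), norm_smul, norm_inv,
    ContinuousMultilinearMap.norm_mkPiAlgebraFin, mul_one, inv_pow,
    mul_inv_le_iff₀ (pow_pos (rho_pos p) _), one_mul]
  exact inv_norm_factorial_le p n

variable {p} in
theorem mem_eball_radius {x : 𝔸} (hx : ‖x‖ * rho p < 1) :
    x ∈ Metric.eball (0 : 𝔸) (NormedSpace.expSeries ℚ_[p] 𝔸).radius := by
  refine Metric.eball_subset_eball (inv_rho_le_radius p) ?_
  rw [Metric.mem_eball, edist_zero_right, ← ofReal_norm, ENNReal.ofReal]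
  have : ‖x‖ < (rho p)⁻¹ := by rwa [← one_div, lt_div_iff₀ (rho_pos p)]
  exact_mod_cast (Real.toNNReal_lt_toNNReal_iff (inv_pos.2 (rho_pos p))).2 this

variable {p} in
theorem exp_add_of_lt {x y : ℚ_[p]} (hx : ‖x‖ * rho p < 1) (hy : ‖y‖ * rho p < 1) :
    NormedSpace.exp (x + y) = NormedSpace.exp x * NormedSpace.exp y :=
  NormedSpace.exp_add_of_mem_ball (𝕂 := ℚ_[p]) (mem_eball_radius hx) (mem_eball_radius hy)

variable {p} in
theorem algebraMap_exp {x : ℚ_[p]} (hx : ‖x‖ * rho p < 1) :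
    algebraMap ℚ_[p] ℂ_[p] (NormedSpace.exp x) = NormedSpace.exp (algebraMap ℚ_[p] ℂ_[p] x) :=
  NormedSpace.algebraMap_exp_comm_of_mem_ball x (mem_eball_radius hx)

variable {p} in
theorem exp_ne_zero_of_lt {x : ℚ_[p]} (hx : ‖x‖ * rho p < 1) : NormedSpace.exp x ≠ 0 :=
  (NormedSpace.isUnit_exp_of_mem_ball (𝕂 := ℚ_[p]) (mem_eball_radius hx)).ne_zero

variable {p} in
theorem exp_natCast_mul {x : ℚ_[p]} (hx : ‖x‖ * rho p < 1) (n : ℕ) :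
    NormedSpace.exp (n * x) = NormedSpace.exp x ^ n := by
  induction n with
  | zero => simp [NormedSpace.exp_zero]
  | succ n ih =>
    rw [Nat.cast_succ, add_mul, one_mul, exp_add_of_lt _ hx, ih, pow_succ]
    rw [norm_mul]
    have h : ‖(n : ℚ_[p])‖ ≤ 1 := by exact_mod_cast Padic.norm_int_le_one (n : ℤ)
    calc ‖(n : ℚ_[p])‖ * ‖x‖ * rho p = ‖(n : ℚ_[p])‖ * (‖x‖ * rho p) := by ring
      _ ≤ 1 * (‖x‖ * rho p) :=
        mul_le_mul_of_nonneg_right h (mul_nonneg (norm_nonneg _) (rho_pos p).le)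
      _ < 1 := by rwa [one_mul]

variable {p} in
theorem exp_intCast_mul {x : ℚ_[p]} (hx : ‖x‖ * rho p < 1) (n : ℤ) :
    NormedSpace.exp (n * x) = NormedSpace.exp x ^ n := by
  obtain ⟨m, rfl | rfl⟩ := n.eq_nat_or_neg
  · simpa using exp_natCast_mul hx m
  · have h : NormedSpace.exp (-x) = (NormedSpace.exp x)⁻¹ :=
      NormedSpace.exp_neg_of_mem_ball (𝕂 := ℚ_[p]) (mem_eball_radius hx)
    have := exp_natCast_mul (x := -x) (by rwa [norm_neg]) m
    rw [h] at this
    simpa using this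

end Exp

/-! ### Inversion of `S` by the falling factorial series. -/

theorem norm_toCp_le_one (x : ℤ_[p]) : ‖toCp p x‖ ≤ 1 := by
  change ‖algebraMap ℚ_[p] ℂ_[p] (x : ℚ_[p])‖ ≤ 1
  rw [norm_algebraMap']
  exact PadicInt.norm_le_one _

theorem norm_toCp (x : ℤ_[p]) : ‖toCp p x‖ = ‖x‖ :=
  norm_algebraMap' ℂ_[p] (x : ℚ_[p])

theorem norm_natCast_cp (n : ℕ) : ‖(n : ℂ_[p])‖ = ‖(n : ℚ_[p])‖ := by
  rw [← map_natCast (algebraMap ℚ_[p] ℂ_[p]), norm_algebraMap']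

theorem norm_natCast_cp_le_one (n : ℕ) : ‖(n : ℂ_[p])‖ ≤ 1 := by
  rw [norm_natCast_cp]
  exact_mod_cast Padic.norm_int_le_one (n : ℤ)

variable {p} in
theorem factorial_mul_choose (x : ℤ_[p]) (n : ℕ) :
    (n.factorial : ℤ_[p]) * Ring.choose x n = (descPochhammer ℤ_[p] n).eval x := by
  rw [← nsmul_eq_mul, ← Ring.descPochhammer_eq_factorial_smul_choose,
    ← descPochhammer_map (Int.castRingHom ℤ_[p]) n, Polynomial.eval_map,
    ← Polynomial.eval₂_smulOneHom_eq_smeval]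
  congr 1
  exact RingHom.ext_int _ _

variable {p} in
theorem mul_descPochhammer_eval_sub_one (x : ℤ_[p]) (n : ℕ) :
    x * (descPochhammer ℤ_[p] n).eval (x - 1) = (descPochhammer ℤ_[p] (n + 1)).eval x := by
  rw [descPochhammer_succ_left]
  simp

variable {p} in
theorem mul_choose_sub_one (x : ℤ_[p]) (n : ℕ) :
    x * Ring.choose (x - 1) n = (n + 1) * Ring.choose x (n + 1) := by
  have hn : (n.factorial : ℤ_[p]) ≠ 0 := Nat.cast_ne_zero.2 n.factorial_ne_zero
  refine mul_left_cancel₀ hn ?_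
  have h := mul_descPochhammer_eval_sub_one x n
  rw [← factorial_mul_choose, ← factorial_mul_choose, Nat.factorial_succ] at h
  push_cast at h
  linear_combination h

/-- The functions `x ↦ (x)_n g(x - n)`, whose sum is the inverse image of `g` under `S`. -/
noncomputable def fallTerm (g : C(ℤ_[p], ℂ_[p])) (n : ℕ) : C(ℤ_[p], ℂ_[p]) where
  toFun x := toCp p ((descPochhammer ℤ_[p] n).eval x) * g (x - n)
  continuous_toFun := ((continuous_toCp p).comp (Polynomial.continuous _)).mul
    (g.continuous.comp (continuous_id.sub continuous_const))

theorem fallTerm_apply (g : C(ℤ_[p], ℂ_[p])) (n : ℕ) (x : ℤ_[p]) :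
    fallTerm p g n x = toCp p ((descPochhammer ℤ_[p] n).eval x) * g (x - n) := rfl

theorem norm_fallTerm_le (g : C(ℤ_[p], ℂ_[p])) (n : ℕ) :
    ‖fallTerm p g n‖ ≤ p * ‖g‖ * kappa p ^ n := by
  have hk := (kappa_pos p).le
  refine (ContinuousMap.norm_le _ (by positivity)).2 fun x => ?_
  rw [fallTerm_apply, ← factorial_mul_choose, map_mul, map_natCast, norm_mul, norm_mul,
    norm_natCast_cp]
  calc ‖(n.factorial : ℚ_[p])‖ * ‖toCp p (Ring.choose x n)‖ * ‖g (x - n)‖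
      ≤ (p * kappa p ^ n) * 1 * ‖g‖ := by
        gcongr
        · exact norm_factorial_le p n
        · exact norm_toCp_le_one p _
        · exact g.norm_coe_le_norm _
    _ = _ := by ring

theorem summable_fallTerm (g : C(ℤ_[p], ℂ_[p])) : Summable (fallTerm p g) :=
  Summable.of_norm_bounded
    ((summable_geometric_of_lt_one (kappa_pos p).le (kappa_lt_one p)).mul_left _)
    (norm_fallTerm_le p g)

theorem hasSum_fallTerm_apply (g : C(ℤ_[p], ℂ_[p])) (x : ℤ_[p]) :
    HasSum (fun n => fallTerm p g n x) ((∑' n, fallTerm p g n) x) :=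
  ContinuousMap.hasSum_apply (summable_fallTerm p g).hasSum x

theorem S_apply (f : C(ℤ_[p], ℂ_[p])) (x : ℤ_[p]) :
    S p f x = f x - toCp p x * f (x - 1) := rfl

/-- Telescoping: `f ↦ x f(x - 1)` turns the `n`-th term into the `(n + 1)`-st, so only the term `n =
0`, which is `g`, survives. -/
theorem S_tsum_fallTerm (g : C(ℤ_[p], ℂ_[p])) : S p (∑' n, fallTerm p g n) = g := by
  ext x
  rw [S_apply]
  have h1 := hasSum_fallTerm_apply p g x
  have h2 := (hasSum_fallTerm_apply p g (x - 1)).mul_left (toCp p x)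
  have h3 : ∀ n, toCp p x * fallTerm p g n (x - 1) = fallTerm p g (n + 1) x := fun n => by
    rw [fallTerm_apply, fallTerm_apply, ← mul_descPochhammer_eval_sub_one, map_mul, mul_assoc,
      show x - 1 - (n : ℤ_[p]) = x - ((n + 1 : ℕ) : ℤ_[p]) by push_cast; ring]
  simp_rw [h3] at h2
  have h4 := h1.unique ((hasSum_nat_add_iff 1).1 h2)
  rw [h4]
  simp [fallTerm_apply]

theorem S_injective : Function.Injective (S p) := by
  rw [← LinearMap.ker_eq_bot, LinearMap.ker_eq_bot']
  intro f hf
  have h : ∀ x, f x = toCp p x * f (x - 1) := fun x =>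
    sub_eq_zero.1 (by rw [← S_apply, hf]; rfl)
  have hn : ∀ n : ℕ, f (n : ℤ_[p]) = 0 := by
    intro n
    induction n with
    | zero => rw [h]; simp
    | succ n ih => rw [h, Nat.cast_succ, add_sub_cancel_right, ih, mul_zero]
  have := PadicInt.denseRange_natCast (p := p) |>.equalizer f.continuous
    (continuous_const (y := (0 : ℂ_[p]))) (funext hn)
  ext x
  exact congrFun this x

theorem S_bijective : Function.Bijective (S p) :=
  ⟨S_injective p, fun g => ⟨_, S_tsum_fallTerm p g⟩⟩

variable {p} in
theorem SInv_eq_of_S_eq {f g : C(ℤ_[p], ℂ_[p])} (h : S p f = g) : SInv p g = f := by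
  rw [← h]
  exact Function.leftInverse_invFun (S_injective p) f

theorem SInv_eq_tsum (g : C(ℤ_[p], ℂ_[p])) : SInv p g = ∑' n, fallTerm p g n :=
  SInv_eq_of_S_eq (S_tsum_fallTerm p g)

/-! ### The Mahler series and the values at natural numbers. -/

/-- The Mahler coefficients of `S⁻¹(x ↦ r ^ x)`. -/
noncomputable def mahlerCoeff (r : ℂ_[p]) (n : ℕ) : ℂ_[p] :=
  ∑ k ∈ Finset.range (n + 1), (n.factorial : ℂ_[p]) / (k.factorial : ℂ_[p]) * (r - 1) ^ k

theorem mahlerCoeff_zero (r : ℂ_[p]) : mahlerCoeff p r 0 = 1 := by simp [mahlerCoeff]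

theorem mahlerCoeff_succ (r : ℂ_[p]) (n : ℕ) :
    mahlerCoeff p r (n + 1) = (n + 1) * mahlerCoeff p r n + (r - 1) ^ (n + 1) := by
  have h : ((n + 1).factorial : ℂ_[p]) ≠ 0 := Nat.cast_ne_zero.2 (Nat.factorial_ne_zero _)
  rw [mahlerCoeff, Finset.sum_range_succ, div_self h, one_mul, mahlerCoeff, Finset.mul_sum,
    Nat.factorial_succ]
  push_cast
  congr 1
  exact Finset.sum_congr rfl fun k _ => by ring

/-- The rate of decay of the Mahler coefficients of `S⁻¹(x ↦ r ^ x)`. -/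
noncomputable def mahlerRate (r : ℂ_[p]) : ℝ := max (kappa p) ‖r - 1‖

theorem mahlerRate_pos (r : ℂ_[p]) : 0 < mahlerRate p r := lt_max_of_lt_left (kappa_pos p)

variable {p} in
theorem mahlerRate_lt_one {r : ℂ_[p]} (hr : ‖r - 1‖ < 1) : mahlerRate p r < 1 :=
  max_lt (kappa_lt_one p) hr

/-- Since `n!/k! = (n choose k) (n - k)!`, each summand is bounded by `|(n - k)!| |r - 1|^k`; the
ultrametric inequality then bounds the sum by its largest term. -/
theorem norm_mahlerCoeff_le (r : ℂ_[p]) (n : ℕ) :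
    ‖mahlerCoeff p r n‖ ≤ p * mahlerRate p r ^ n := by
  have hpos := mahlerRate_pos p r
  refine IsUltrametricDist.norm_sum_le_of_forall_le_of_nonneg (by positivity) fun k hk => ?_
  have hkn : k ≤ n := Nat.lt_succ_iff.1 (Finset.mem_range.1 hk)
  have h : (n.factorial : ℂ_[p]) / (k.factorial : ℂ_[p]) =
      (n.choose k : ℂ_[p]) * ((n - k).factorial : ℂ_[p]) := by
    rw [div_eq_iff (Nat.cast_ne_zero.2 k.factorial_ne_zero),
      ← Nat.choose_mul_factorial_mul_factorial hkn]
    push_cast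
    ring
  rw [h, norm_mul, norm_mul, norm_pow, norm_natCast_cp p (n - k).factorial]
  calc ‖(n.choose k : ℂ_[p])‖ * ‖((n - k).factorial : ℚ_[p])‖ * ‖r - 1‖ ^ k
      ≤ 1 * (p * mahlerRate p r ^ (n - k)) * mahlerRate p r ^ k := by
        gcongr
        · exact norm_natCast_cp_le_one p _
        · refine (norm_factorial_le p _).trans ?_
          have := (kappa_pos p).le
          gcongr
          exact le_max_left _ _
        · exact le_max_right _ _
    _ = p * mahlerRate p r ^ n := by
        rw [one_mul, mul_assoc, ← pow_add, Nat.sub_add_cancel hkn]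

variable {p} in
theorem tendsto_mahlerCoeff {r : ℂ_[p]} (hr : ‖r - 1‖ < 1) :
    Tendsto (mahlerCoeff p r) atTop (𝓝 0) := by
  refine squeeze_zero_norm (norm_mahlerCoeff_le p r) ?_
  simpa using (tendsto_pow_atTop_nhds_zero_of_lt_one (mahlerRate_pos p r).le
    (mahlerRate_lt_one hr)).const_mul (p : ℝ)

variable {p} in
theorem summable_mahlerCoeff_smul {r : ℂ_[p]} (hr : ‖r - 1‖ < 1) :
    Summable fun n => mahlerCoeff p r n • binomFun p n := by
  refine Summable.of_norm_bounded ((summable_geometric_of_lt_one (mahlerRate_pos p r).le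
    (mahlerRate_lt_one hr)).mul_left (p : ℝ)) fun n => ?_
  rw [norm_smul]
  exact (mul_le_of_le_one_right (norm_nonneg _) (norm_binomFun_le p n)).trans
    (norm_mahlerCoeff_le p r n)

theorem binomFun_apply (n : ℕ) (x : ℤ_[p]) : binomFun p n x = toCp p (Ring.choose x n) := rfl

-- The equation is checked coefficient by coefficient: `mul_choose_sub_one` makes it the recursion
-- `mahlerCoeff_succ`, after the index of the unshifted series is moved by one.
variable {p} in
theorem S_tsum_mahlerCoeff_smul {r : ℂ_[p]} (hr : ‖r - 1‖ < 1) :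
    S p (∑' n, mahlerCoeff p r n • binomFun p n) = powFun p r := by
  ext x
  rw [S_apply]
  have h1 := ContinuousMap.hasSum_apply (summable_mahlerCoeff_smul hr).hasSum x
  have h2 := (ContinuousMap.hasSum_apply (summable_mahlerCoeff_smul hr).hasSum (x - 1)).mul_left
    (toCp p x)
  have h3 := ContinuousMap.hasSum_apply (summable_powFun p r hr).hasSum x
  have h4 := ((hasSum_nat_add_iff' 1).2 h1).sub h2
  have h5 := (hasSum_nat_add_iff' 1).2 h3
  have h6 : ∀ n, (mahlerCoeff p r (n + 1) • binomFun p (n + 1)) x -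
      toCp p x * (mahlerCoeff p r n • binomFun p n) (x - 1) =
      ((r - 1) ^ (n + 1) • binomFun p (n + 1)) x := fun n => by
    have h := congrArg (toCp p) (mul_choose_sub_one x n)
    simp only [map_mul, map_add, map_natCast, map_one] at h
    simp only [ContinuousMap.smul_apply, smul_eq_mul, binomFun_apply, mahlerCoeff_succ]
    linear_combination -(mahlerCoeff p r n) * h
  simp_rw [h6] at h4
  have h7 := h4.unique h5
  simp only [Finset.range_one, Finset.sum_singleton, mahlerCoeff_zero, pow_zero] at h7
  rw [powFun]
  linear_combination h7

variable {p} in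
theorem SInv_powFun {r : ℂ_[p]} (hr : ‖r - 1‖ < 1) :
    SInv p (powFun p r) = ∑' n, mahlerCoeff p r n • binomFun p n :=
  SInv_eq_of_S_eq (S_tsum_mahlerCoeff_smul hr)

variable {p} in
theorem hasSum_SInv_powFun {r : ℂ_[p]} (hr : ‖r - 1‖ < 1) (x : ℤ_[p]) :
    HasSum (fun n => mahlerCoeff p r n * toCp p (Ring.choose x n)) (SInv p (powFun p r) x) := by
  rw [SInv_powFun hr]
  exact ContinuousMap.hasSum_apply (summable_mahlerCoeff_smul hr).hasSum x

variable {p} in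
theorem continuous_gammaBar (r : ℂ_[p]) : Continuous (gammaBar p r) :=
  continuous_const.mul ((SInv p (powFun p r)).continuous.comp (continuous_id.sub continuous_const))

variable {p} in
theorem hasSum_gammaBar_mahler {r : ℂ_[p]} (hr : ‖r - 1‖ < 1) (x : ℤ_[p]) :
    HasSum (fun n => (NormedSpace.exp (r * (pTilde p : ℂ_[p])) * mahlerCoeff p r n) *
      toCp p (Ring.choose x n)) (gammaBar p r (x + 1)) := by
  have h := (hasSum_SInv_powFun hr x).mul_left (NormedSpace.exp (r * (pTilde p : ℂ_[p])))
  simp_rw [← mul_assoc] at h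
  rw [gammaBar, add_sub_cancel_right]
  exact h

variable {p} in
theorem hasSum_SInv (g : C(ℤ_[p], ℂ_[p])) (x : ℤ_[p]) :
    HasSum (fun n : ℕ => toCp p ((descPochhammer ℤ_[p] n).eval x) * g (x - n)) (SInv p g x) := by
  rw [SInv_eq_tsum]
  exact hasSum_fallTerm_apply p g x

variable {p} in
/-- The values of `S⁻¹(x ↦ r ^ x)` at natural numbers. -/
theorem SInv_powFun_natCast {r : ℂ_[p]} (hr : ‖r - 1‖ < 1) (m : ℕ) :
    SInv p (powFun p r) (m : ℤ_[p]) =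
      ∑ k ∈ Finset.range (m + 1), (m.factorial : ℂ_[p]) / (k.factorial : ℂ_[p]) * r ^ k := by
  have hS : S p (SInv p (powFun p r)) = powFun p r := by
    rw [SInv_powFun hr, S_tsum_mahlerCoeff_smul hr]
  -- The functional equation `f(x) = x f(x - 1) + r^x` determines `f` on `ℕ`, starting from `f(0) =
  -- 1`.
  have h : ∀ x, SInv p (powFun p r) x =
      toCp p x * SInv p (powFun p r) (x - 1) + powFun p r x := fun x => by
    conv_rhs => rw [← hS, S_apply]
    rw [hS]
    ring
  induction m with
  | zero =>
    rw [h, powFun_natCast p r hr]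
    simp
  | succ m ih =>
    have h1 : ((m + 1).factorial : ℂ_[p]) ≠ 0 := Nat.cast_ne_zero.2 (Nat.factorial_ne_zero _)
    rw [h, powFun_natCast p r hr, Nat.cast_succ, add_sub_cancel_right, ih,
      Finset.sum_range_succ _ (m + 1), div_self h1, one_mul, Finset.mul_sum, Nat.factorial_succ]
    congr 1
    refine Finset.sum_congr rfl fun k _ => ?_
    push_cast [map_add, map_natCast, map_one]
    ring

/-! ### Local analyticity from geometric decay of Mahler coefficients. -/

theorem norm_coeff_descPochhammer_mul_le {K : Type*} [NormedField K] [IsUltrametricDist K]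
    {δ : ℝ} (hδ : 0 ≤ δ) (i m : ℕ) :
    ‖(descPochhammer K i).coeff m‖ * δ ^ m ≤ ∏ j ∈ Finset.range i, max δ ‖(j : K)‖ := by
  have hG : ∀ i, 0 ≤ ∏ j ∈ Finset.range i, max δ ‖(j : K)‖ := fun i =>
    Finset.prod_nonneg fun j _ => hδ.trans (le_max_left _ _)
  induction i generalizing m with
  | zero =>
    rcases eq_or_ne m 0 with rfl | hm
    · simp
    · simp [Polynomial.coeff_one, hm]
  | succ i ih =>
    have h2 : ‖(descPochhammer K i).coeff m * (i : K)‖ * δ ^ m ≤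
        ∏ j ∈ Finset.range (i + 1), max δ ‖(j : K)‖ := by
      rw [Finset.prod_range_succ, norm_mul, mul_right_comm]
      exact mul_le_mul (ih m) (le_max_right _ _) (norm_nonneg _) (hG i)
    -- The factor `X - i` multiplies the Gauss norm of radius `δ` by at most `max δ |i|`.
    rw [descPochhammer_succ_right, mul_sub, Polynomial.coeff_sub, ← Polynomial.C_eq_natCast,
      Polynomial.coeff_mul_C]
    rcases m with _ | m
    · rw [Polynomial.mul_coeff_zero, Polynomial.coeff_X_zero, mul_zero, zero_sub, norm_neg]
      exact h2
    · rw [Polynomial.coeff_mul_X]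
      have h1 : ‖(descPochhammer K i).coeff m‖ * δ ^ (m + 1) ≤
          ∏ j ∈ Finset.range (i + 1), max δ ‖(j : K)‖ := by
        rw [Finset.prod_range_succ, pow_succ, ← mul_assoc]
        exact mul_le_mul (ih m) (le_max_left _ _) hδ (hG i)
      rw [sub_eq_add_neg]
      refine (mul_le_mul_of_nonneg_right (IsUltrametricDist.norm_add_le_max _ _)
        (pow_nonneg hδ _)).trans ?_
      rw [max_mul_of_nonneg _ _ (pow_nonneg hδ _), norm_neg]
      exact max_le h1 h2

/-- Indices not divisible by `p^N` contribute their own norm. A multiple `p^N k` contributes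
`p^(-N)` instead of `p^(-N) |k|`, and these excess factors multiply to the inverse of `|⌊i/p^N⌋!|`.
-/
theorem prod_max_norm_succ_mul_le (N i : ℕ) :
    (∏ j ∈ Finset.range i, max ((p : ℝ) ^ (-N : ℤ)) ‖((j + 1 : ℕ) : ℚ_[p])‖) *
      ‖((i / p ^ N).factorial : ℚ_[p])‖ ≤ ‖(i.factorial : ℚ_[p])‖ := by
  have hq : 0 < p ^ N := pow_pos (Fact.out : p.Prime).pos _
  induction i with
  | zero => simp
  | succ i ih =>
    rw [Finset.prod_range_succ, Nat.factorial_succ, Nat.succ_div]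
    have hnonneg : 0 ≤ ∏ j ∈ Finset.range i, max ((p : ℝ) ^ (-N : ℤ)) ‖((j + 1 : ℕ) : ℚ_[p])‖ :=
      Finset.prod_nonneg fun j _ => (norm_nonneg _).trans (le_max_right _ _)
    by_cases hd : p ^ N ∣ i + 1
    · have h1 : ‖((i + 1 : ℕ) : ℚ_[p])‖ = (p : ℝ) ^ (-N : ℤ) * ‖((i / p ^ N + 1 : ℕ) : ℚ_[p])‖ := by
        obtain ⟨k, hk⟩ := hd
        have h2 : i / p ^ N + 1 = k := by
          have := Nat.succ_div (a := i) (b := p ^ N)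
          rw [if_pos ⟨k, hk⟩, hk, Nat.mul_div_cancel_left _ hq] at this
          exact this.symm
        rw [h2, hk, Nat.cast_mul, norm_mul, Nat.cast_pow, norm_pow, Padic.norm_p, zpow_neg,
          zpow_natCast, inv_pow]
      have h3 : ‖((i / p ^ N + 1 : ℕ) : ℚ_[p])‖ ≤ 1 := by
        exact_mod_cast Padic.norm_int_le_one (p := p) ((i / p ^ N + 1 : ℕ) : ℤ)
      have h4 : (0 : ℝ) ≤ (p : ℝ) ^ (-N : ℤ) := zpow_nonneg (prime_pos_real p).le _
      rw [if_pos hd, Nat.factorial_succ, Nat.cast_mul, norm_mul, Nat.cast_mul, norm_mul, h1,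
        max_eq_left (mul_le_of_le_one_right h4 h3)]
      calc _ = ((p : ℝ) ^ (-N : ℤ) * ‖((i / p ^ N + 1 : ℕ) : ℚ_[p])‖) *
            ((∏ j ∈ Finset.range i, max ((p : ℝ) ^ (-N : ℤ)) ‖((j + 1 : ℕ) : ℚ_[p])‖) *
              ‖((i / p ^ N).factorial : ℚ_[p])‖) := by ring
        _ ≤ _ := mul_le_mul_of_nonneg_left ih (mul_nonneg h4 (norm_nonneg _))
    · have h1 : (p : ℝ) ^ (-N : ℤ) ≤ ‖((i + 1 : ℕ) : ℚ_[p])‖ := by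
        by_contra! h
        refine hd ?_
        have := (Padic.norm_int_le_pow_iff_dvd (p := p) ((i + 1 : ℕ) : ℤ) N).1
          (by exact_mod_cast h.le)
        exact_mod_cast this
      rw [if_neg hd, add_zero, max_eq_right h1, Nat.cast_mul, norm_mul]
      calc _ = ‖((i + 1 : ℕ) : ℚ_[p])‖ *
            ((∏ j ∈ Finset.range i, max ((p : ℝ) ^ (-N : ℤ)) ‖((j + 1 : ℕ) : ℚ_[p])‖) *
              ‖((i / p ^ N).factorial : ℚ_[p])‖) := by ring
        _ ≤ _ := mul_le_mul_of_nonneg_left ih (norm_nonneg _)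

theorem prod_max_norm_mul_le (N i : ℕ) :
    (∏ j ∈ Finset.range i, max ((p : ℝ) ^ (-N : ℤ)) ‖(j : ℚ_[p])‖) ≤
      ‖(i.factorial : ℚ_[p])‖ * rho p ^ (i / p ^ N) := by
  have hδ : (0 : ℝ) < (p : ℝ) ^ (-N : ℤ) := zpow_pos (prime_pos_real p) _
  have h1 : (∏ j ∈ Finset.range i, max ((p : ℝ) ^ (-N : ℤ)) ‖(j : ℚ_[p])‖) ≤
      ∏ j ∈ Finset.range i, max ((p : ℝ) ^ (-N : ℤ)) ‖((j + 1 : ℕ) : ℚ_[p])‖ := by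
    have h2 := Finset.prod_range_succ (fun j : ℕ => max ((p : ℝ) ^ (-N : ℤ)) ‖(j : ℚ_[p])‖) i
    rw [Finset.prod_range_succ', Nat.cast_zero, norm_zero, max_eq_left hδ.le] at h2
    refine le_of_mul_le_mul_right ?_ hδ
    rw [h2]
    exact mul_le_mul_of_nonneg_left (le_max_left _ _)
      (Finset.prod_nonneg fun j _ => hδ.le.trans (le_max_left _ _))
  have h3 := prod_max_norm_succ_mul_le p N i
  have h4 : 0 < ‖((i / p ^ N).factorial : ℚ_[p])‖ :=
    norm_pos_iff.2 (Nat.cast_ne_zero.2 (Nat.factorial_ne_zero _))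
  rw [← le_div_iff₀ h4, div_eq_mul_inv] at h3
  exact (h1.trans h3).trans (mul_le_mul_of_nonneg_left (inv_norm_factorial_le p _) (norm_nonneg _))

/-- The polynomial `x (x - 1) ⋯ (x - i + 1) / i!` over `ℂ_[p]`. -/
noncomputable def binomPoly (i : ℕ) : Polynomial ℂ_[p] :=
  Polynomial.C ((i.factorial : ℂ_[p])⁻¹) * descPochhammer ℂ_[p] i

theorem eval_binomPoly (i : ℕ) (y : ℤ_[p]) :
    (binomPoly p i).eval (toCp p y) = toCp p (Ring.choose y i) := by
  have h : (descPochhammer ℂ_[p] i).eval (toCp p y) = toCp p ((descPochhammer ℤ_[p] i).eval y) := by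
    rw [← descPochhammer_map (toCp p), Polynomial.eval_map, Polynomial.eval₂_at_apply]
  rw [binomPoly, Polynomial.eval_mul, Polynomial.eval_C, h, ← factorial_mul_choose, map_mul,
    map_natCast, inv_mul_cancel_left₀ (Nat.cast_ne_zero.2 i.factorial_ne_zero)]

/-- Division by `i!` cancels the main part of the Gauss norm. The remaining growth in `i` has
exponential rate `rho p ^ (1 / p^N)`, as close to `1` as desired. -/
theorem norm_coeff_binomPoly_mul_le (N i m : ℕ) :
    ‖(binomPoly p i).coeff m‖ * ((p : ℝ) ^ (-N : ℤ)) ^ m ≤ rho p ^ (i / p ^ N) := by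
  have hδ : (0 : ℝ) ≤ (p : ℝ) ^ (-N : ℤ) := zpow_nonneg (prime_pos_real p).le _
  have h1 := norm_coeff_descPochhammer_mul_le (K := ℂ_[p]) hδ i m
  simp_rw [norm_natCast_cp] at h1
  have h2 := h1.trans (prod_max_norm_mul_le p N i)
  have h3 : 0 < ‖(i.factorial : ℚ_[p])‖ :=
    norm_pos_iff.2 (Nat.cast_ne_zero.2 i.factorial_ne_zero)
  rw [binomPoly, Polynomial.coeff_C_mul, norm_mul, norm_inv, norm_natCast_cp, mul_assoc,
    inv_mul_le_iff₀ h3]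
  exact h2

theorem exists_pow_mul_lt_one {σ ρ : ℝ} (hσ0 : 0 ≤ σ) (hσ1 : σ < 1) :
    ∃ N : ℕ, ρ * σ ^ p ^ N < 1 := by
  have h1 : Tendsto (fun N : ℕ => p ^ N) atTop atTop :=
    tendsto_pow_atTop_atTop_of_one_lt (Fact.out : p.Prime).one_lt
  have h2 := ((tendsto_pow_atTop_nhds_zero_of_lt_one hσ0 hσ1).comp h1).const_mul ρ
  rw [mul_zero] at h2
  exact (h2.eventually_lt_const one_pos).exists

theorem hasSum_antidiagonal_of_summable {F : ℕ × ℕ → ℂ_[p]} (hF : Summable F) :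
    HasSum (fun n => ∑ ij ∈ Finset.HasAntidiagonal.antidiagonal n, F ij) (∑' ij, F ij) := by
  have h := (Finset.HasAntidiagonal.sigmaAntidiagonalEquivProd (A := ℕ)).hasSum_iff.2 hF.hasSum
  refine h.sigma fun n => ?_
  rw [← Finset.sum_coe_sort]
  exact hasSum_fintype _

/-- Mahler series may be recentred. -/
theorem exists_mahler_recenter {c : ℕ → ℂ_[p]} {C σ : ℝ} (hC : 0 ≤ C) (hσ0 : 0 ≤ σ) (hσ1 : σ < 1)
    (hc : ∀ n, ‖c n‖ ≤ C * σ ^ n) {f : ℤ_[p] → ℂ_[p]}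
    (hf : ∀ x, HasSum (fun n => c n * toCp p (Ring.choose x n)) (f x)) (x₀ : ℤ_[p]) :
    ∃ (b : ℕ → ℂ_[p]) (D : ℝ), 0 ≤ D ∧ (∀ i, ‖b i‖ ≤ D * σ ^ i) ∧
      ∀ y, HasSum (fun i => b i * toCp p (Ring.choose y i)) (f (y + x₀)) := by
  have hgeo := summable_geometric_of_lt_one hσ0 hσ1
  have hbound : ∀ i j, ‖c (i + j) * toCp p (Ring.choose x₀ j)‖ ≤ C * σ ^ i * σ ^ j := fun i j => by
    rw [norm_mul, mul_assoc, ← pow_add]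
    exact (mul_le_of_le_one_right (norm_nonneg _) (norm_toCp_le_one p _)).trans (hc _)
  have hrow : ∀ i, Summable fun j => c (i + j) * toCp p (Ring.choose x₀ j) := fun i =>
    Summable.of_norm_bounded (hgeo.mul_left _) (hbound i)
  refine ⟨fun i => ∑' j, c (i + j) * toCp p (Ring.choose x₀ j), C * ∑' j, σ ^ j,
    mul_nonneg hC (tsum_nonneg fun j => pow_nonneg hσ0 j), fun i => ?_, fun y => ?_⟩
  · refine (tsum_of_norm_bounded (hgeo.mul_left (C * σ ^ i)).hasSum (hbound i)).trans_eq ?_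
    rw [tsum_mul_left]
    ring
  · set F : ℕ × ℕ → ℂ_[p] := fun ij =>
      c (ij.1 + ij.2) * toCp p (Ring.choose x₀ ij.2) * toCp p (Ring.choose y ij.1) with hFdef
    have hF : Summable F := by
      refine Summable.of_norm_bounded (Summable.mul_of_nonneg (hgeo.mul_left C) hgeo
        (fun i => mul_nonneg hC (pow_nonneg hσ0 i)) fun j => pow_nonneg hσ0 j) fun ij => ?_
      simp only [hFdef]
      rw [norm_mul]
      exact (mul_le_of_le_one_right (norm_nonneg _) (norm_toCp_le_one p _)).trans
        (hbound ij.1 ij.2)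
    have h1 := hasSum_antidiagonal_of_summable p hF
    have h2 : ∀ n, ∑ ij ∈ Finset.HasAntidiagonal.antidiagonal n, F ij =
        c n * toCp p (Ring.choose (y + x₀) n) := by
      intro n
      -- Chu–Vandermonde: the diagonals of the double series give the Mahler series at `y + x₀`,
      -- while its rows give the recentred one.
      rw [Ring.add_choose_eq n (Commute.all y x₀), map_sum, Finset.mul_sum]
      refine Finset.sum_congr rfl fun ij hij => ?_
      rw [hFdef, ← Finset.HasAntidiagonal.mem_antidiagonal.1 hij, map_mul]
      ring
    simp_rw [h2] at h1
    rw [(hf (y + x₀)).unique h1]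
    have h3 : ∀ i, HasSum (fun j => F (i, j))
        ((∑' j, c (i + j) * toCp p (Ring.choose x₀ j)) * toCp p (Ring.choose y i)) := fun i =>
      (hrow i).hasSum.mul_right (toCp p (Ring.choose y i))
    exact hF.hasSum.prod_fiberwise h3

/-- A Mahler series with exponentially decaying coefficients is a locally analytic function. -/
theorem isLocallyAnalytic_of_mahler {c : ℕ → ℂ_[p]} {C σ : ℝ} (hC : 0 ≤ C) (hσ0 : 0 ≤ σ)
    (hσ1 : σ < 1) (hc : ∀ n, ‖c n‖ ≤ C * σ ^ n) {f : ℤ_[p] → ℂ_[p]}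
    (hf : ∀ x, HasSum (fun n => c n * toCp p (Ring.choose x n)) (f x)) :
    IsLocallyAnalytic f := by
  intro x₀
  obtain ⟨b, D, hD, hb, hfb⟩ := exists_mahler_recenter p hC hσ0 hσ1 hc hf x₀
  -- `N` is chosen so that `R = rho p ^ (1 / p^N)` satisfies `R σ < 1`: decay of the Mahler
  -- coefficients then beats growth of the binomial polynomials.
  obtain ⟨N, hN⟩ := exists_pow_mul_lt_one p (ρ := rho p) hσ0 hσ1
  set q := p ^ N with hq
  have hq0 : q ≠ 0 := pow_ne_zero _ (Fact.out : p.Prime).ne_zero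
  set R : ℝ := rho p ^ ((q : ℝ)⁻¹) with hR
  have hR1 : 1 ≤ R := Real.one_le_rpow (one_le_rho p) (by positivity)
  have hRq : R ^ q = rho p := Real.rpow_inv_natCast_pow (rho_pos p).le hq0
  have hRσ0 : 0 ≤ R * σ := mul_nonneg (zero_le_one.trans hR1) hσ0
  have hRσ : R * σ < 1 := by
    rw [← hRq, ← mul_pow] at hN
    exact (pow_lt_one_iff_of_nonneg hRσ0 hq0).1 hN
  set δ : ℝ := (p : ℝ) ^ (-N : ℤ) with hδ
  have hδ0 : 0 < δ := zpow_pos (prime_pos_real p) _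
  -- Halving the radius gives a factor `(1/2)^m`, which makes the double series summable in `m` as
  -- well, so the two summations may be exchanged.
  refine ⟨δ / 2, half_pos hδ0, fun m => ∑' i, b i * (binomPoly p i).coeff m, fun x hx => ?_⟩
  set y := x - x₀ with hy
  have hxy : y + x₀ = x := sub_add_cancel x x₀
  have hyn : ‖toCp p y‖ ≤ δ * (1 / 2) := by
    rw [norm_toCp]
    linarith
  set F : ℕ × ℕ → ℂ_[p] := fun mi =>
    b mi.2 * (binomPoly p mi.2).coeff mi.1 * toCp p y ^ mi.1 with hFdef
  have hF : Summable F := by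
    have hs := Summable.mul_of_nonneg
      (summable_geometric_of_lt_one (r := (1 / 2 : ℝ)) (by norm_num) (by norm_num))
      ((summable_geometric_of_lt_one hRσ0 hRσ).mul_left D)
      (fun m => by positivity) (fun i => by positivity)
    refine Summable.of_norm_bounded hs fun mi => ?_
    obtain ⟨m, i⟩ := mi
    simp only [hFdef, norm_mul, norm_pow]
    have h1 : ‖(binomPoly p i).coeff m‖ * δ ^ m ≤ R ^ i := by
      refine (norm_coeff_binomPoly_mul_le p N i m).trans ?_
      rw [← hq, ← hRq, ← pow_mul]
      exact pow_le_pow_right₀ hR1 (Nat.mul_div_le i q)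
    calc ‖b i‖ * ‖(binomPoly p i).coeff m‖ * ‖toCp p y‖ ^ m
        ≤ ‖b i‖ * ‖(binomPoly p i).coeff m‖ * (δ * (1 / 2)) ^ m := by gcongr
      _ = ‖b i‖ * (‖(binomPoly p i).coeff m‖ * δ ^ m) * (1 / 2) ^ m := by rw [mul_pow]; ring
      _ ≤ (D * σ ^ i) * R ^ i * (1 / 2) ^ m := by
          gcongr
          exact hb i
      _ = (1 / 2) ^ m * (D * (R * σ) ^ i) := by rw [mul_pow]; ring
  have hcol : ∀ i, HasSum (fun m => F (m, i)) (b i * toCp p (Ring.choose y i)) := fun i => by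
    rw [← eval_binomPoly, Polynomial.eval_eq_sum_range, Finset.mul_sum]
    simp_rw [← mul_assoc]
    refine hasSum_sum_of_ne_finset_zero fun m hm => ?_
    have : (binomPoly p i).coeff m = 0 := Polynomial.coeff_eq_zero_of_natDegree_lt (by
      rw [Finset.mem_range] at hm
      omega)
    simp [hFdef, this]
  have h1 := ((Equiv.prodComm ℕ ℕ).hasSum_iff.2 hF.hasSum).prod_fiberwise hcol
  have h2 : f x = ∑' mi, F mi := by
    rw [← hxy]
    exact (hfb y).unique h1
  rw [h2]
  have h3 := hF.hasSum.prod_fiberwise fun m => (hF.prod_factor m).hasSum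
  simp only [hFdef, tsum_mul_right] at h3
  exact h3

variable {p} in
theorem isLocallyAnalytic_gammaBar {r : ℂ_[p]} (hr : ‖r - 1‖ < 1) :
    IsLocallyAnalytic (gammaBar p r) := by
  have h := isLocallyAnalytic_of_mahler p (mul_nonneg (norm_nonneg _) (prime_pos_real p).le)
    (mahlerRate_pos p r).le (mahlerRate_lt_one hr)
    (c := fun n => NormedSpace.exp (r * (pTilde p : ℂ_[p])) * mahlerCoeff p r n)
    (fun n => by
      rw [norm_mul, mul_assoc]
      exact mul_le_mul_of_nonneg_left (norm_mahlerCoeff_le p r n) (norm_nonneg _))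
    (hasSum_gammaBar_mahler hr)
  intro x₀
  obtain ⟨ρ, hρ, a, ha⟩ := h (x₀ - 1)
  refine ⟨ρ, hρ, a, fun x hx => ?_⟩
  have := ha (x - 1) (by simpa using hx)
  simpa using this

/-! ### Transcendence of `e`. -/

open Polynomial in
theorem exists_int_poly_eval_zero_ne {A : Type*} [CommRing A] [IsDomain A] {x : A} (hx : x ≠ 0)
    (h : IsAlgebraic ℤ x) : ∃ Q : ℤ[X], Q.coeff 0 ≠ 0 ∧ aeval x Q = 0 := by
  obtain ⟨P, hP, hPx⟩ := h
  obtain ⟨Q, hQ, hnd⟩ := exists_eq_pow_rootMultiplicity_mul_and_not_dvd P hP 0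
  refine ⟨Q, fun h0 => hnd ?_, ?_⟩
  · rw [C_0, sub_zero]
    exact X_dvd_iff.2 h0
  · rw [hQ, map_mul, map_pow, C_0, sub_zero, aeval_X] at hPx
    exact (mul_eq_zero.1 hPx).resolve_left (pow_ne_zero _ hx)

open Polynomial in
/-- Hermite's theorem: `e` is transcendental. -/
theorem transcendental_exp_one : Transcendental ℤ (Complex.exp 1) := by
  intro halg
  obtain ⟨Q, hQ0, hQ⟩ := exists_int_poly_eval_zero_ne (Complex.exp_ne_zero 1) halg
  set d := Q.natDegree with hd
  set f : ℤ[X] := ∏ k ∈ Finset.Icc 1 d, (X - C (k : ℤ)) with hf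
  have hf0 : f.eval 0 ≠ 0 := by
    rw [hf, eval_prod]
    refine Finset.prod_ne_zero_iff.2 fun k hk => ?_
    have := (Finset.mem_Icc.1 hk).1
    simp
    omega
  have hfne : f ≠ 0 := fun h => hf0 (by rw [h, eval_zero])
  have hroots : ∀ k ∈ Finset.Icc 1 d, (k : ℂ) ∈ f.aroots ℂ := fun k hk => by
    rw [mem_aroots]
    refine ⟨hfne, ?_⟩
    rw [hf, map_prod]
    exact Finset.prod_eq_zero hk (by simp)
  obtain ⟨c, hc⟩ := LindemannWeierstrass.exp_polynomial_approx f hf0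
  set A : ℝ := ∑ k ∈ Finset.Icc 1 d, |(Q.coeff k : ℝ)| with hA
  have hlim := (FloorSemiring.tendsto_pow_div_factorial_atTop |c|).const_mul (A * |c|)
  rw [mul_zero] at hlim
  obtain ⟨M, hM⟩ := eventually_atTop.1 (hlim.eventually_lt_const one_pos)
  -- The prime `q` must exceed `M` to make the error small, `|f(0)|` for the approximation to apply,
  -- and `|Q(0)|` so that `q` does not divide `Q(0)`.
  obtain ⟨q, hqge, hq⟩ := Nat.exists_infinite_primes
    (M + 1 + (f.eval 0).natAbs + 1 + (Q.coeff 0).natAbs + 1)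
  obtain ⟨n, hn, gp, -, hgp⟩ := hc q (by omega) hq
  have hq1 : q - 1 + 1 = q := Nat.sub_add_cancel hq.one_le
  -- `m` is `n Q(e)` with each `n e^k` replaced by its approximation `q * gp(k)`. It is nonzero
  -- modulo `q`, yet smaller than `1` because `Q(e) = 0`.
  set m : ℤ := n * Q.coeff 0 + q * ∑ k ∈ Finset.Icc 1 d, Q.coeff k * gp.eval (k : ℤ) with hm
  have hm0 : m ≠ 0 := by
    intro h0
    have hdvd : (q : ℤ) ∣ n * Q.coeff 0 := by
      rw [hm] at h0
      exact ⟨-∑ k ∈ Finset.Icc 1 d, Q.coeff k * gp.eval (k : ℤ), by linear_combination h0⟩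
    rcases (Nat.prime_iff_prime_int.1 hq).dvd_or_dvd hdvd with h | h
    · exact hn h
    · have := Nat.le_of_dvd (Int.natAbs_pos.2 hQ0) (Int.natCast_dvd.1 h)
      omega
  have hm1 : (1 : ℝ) ≤ ‖(m : ℂ)‖ := by
    rw [Complex.norm_intCast]
    exact_mod_cast Int.one_le_abs hm0
  have hsum : (m : ℂ) = -∑ k ∈ Finset.Icc 1 d, (Q.coeff k : ℂ) *
      (n • Complex.exp (k : ℂ) - q • aeval (k : ℂ) gp) := by
    have h1 : aeval (Complex.exp 1) Q = (Q.coeff 0 : ℂ) +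
        ∑ k ∈ Finset.Icc 1 d, (Q.coeff k : ℂ) * Complex.exp (k : ℂ) := by
      rw [aeval_eq_sum_range, Finset.sum_range_succ', add_comm, ← hd]
      congr 1
      · simp
      · rw [Finset.sum_bij' (fun i _ => i + 1) (fun i _ => i - 1)]
        · intro i hi
          rw [Finset.mem_range] at hi
          exact Finset.mem_Icc.2 (by omega)
        · intro i hi
          rw [Finset.mem_Icc] at hi
          exact Finset.mem_range.2 (by omega)
        · intro i _
          simp
        · intro i hi
          rw [Finset.mem_Icc] at hi
          omega
        · intro i _
          rw [← Complex.exp_nat_mul, mul_one, zsmul_eq_mul]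
    have h2 : ∀ k : ℕ, ((gp.eval (k : ℤ) : ℤ) : ℂ) = aeval (k : ℂ) gp := fun k => by
      have := aeval_algebraMap_apply ℂ (k : ℤ) gp
      simpa using this.symm
    rw [hQ] at h1
    rw [hm]
    push_cast
    simp_rw [h2, mul_sub, Finset.sum_sub_distrib, zsmul_eq_mul, nsmul_eq_mul]
    simp_rw [mul_left_comm _ (n : ℂ), mul_left_comm _ (q : ℂ), ← Finset.mul_sum]
    linear_combination -(n : ℂ) * h1
  have hle : ‖(m : ℂ)‖ ≤ A * (|c| ^ q / (q - 1).factorial) := by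
    rw [hsum, norm_neg, hA, Finset.sum_mul]
    refine (norm_sum_le _ _).trans (Finset.sum_le_sum fun k hk => ?_)
    rw [norm_mul, Complex.norm_intCast]
    refine mul_le_mul_of_nonneg_left ((hgp (hroots k hk)).trans ?_) (abs_nonneg _)
    refine div_le_div_of_nonneg_right ?_ (Nat.cast_nonneg _)
    rw [← abs_pow]
    exact le_abs_self _
  have hlt := hM (q - 1) (by omega)
  rw [← hq1, pow_succ, Nat.add_sub_cancel] at hle
  have : A * (|c| ^ (q - 1) * |c| / (q - 1).factorial) =
      A * |c| * (|c| ^ (q - 1) / (q - 1).factorial) := by ring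
  rw [this] at hle
  linarith

/-! ### Zero estimate for exponential polynomials, by Wronskians. -/

section ExpPoly

open Polynomial

variable {F : Type*} [Field F]

/-- The operator `A ↦ A' + a A`, which is conjugate to differentiation by `exp (a X)`. -/
noncomputable def twD {R : Type*} [CommRing R] (a : R) (A : R[X]) : R[X] := derivative A + C a * A

/-- The formal power series of `exp (a X)`. -/
noncomputable def expSer (a : F) : PowerSeries F :=
  PowerSeries.mk fun n => a ^ n / (n.factorial : F)

theorem derivative_expSer [CharZero F] (a : F) :
    PowerSeries.derivative F (expSer a) = PowerSeries.C a * expSer a := by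
  ext n
  have h1 : ((n : F) + 1) ≠ 0 := Nat.cast_add_one_ne_zero n
  have h2 : (n.factorial : F) ≠ 0 := Nat.cast_ne_zero.2 n.factorial_ne_zero
  rw [PowerSeries.coeff_derivative, PowerSeries.coeff_C_mul, expSer, PowerSeries.coeff_mk,
    PowerSeries.coeff_mk, Nat.factorial_succ]
  push_cast
  field_simp
  ring

theorem isUnit_expSer (a : F) : IsUnit (expSer a) := by
  rw [PowerSeries.isUnit_iff_constantCoeff, ← PowerSeries.coeff_zero_eq_constantCoeff_apply,
    expSer, PowerSeries.coeff_mk]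
  simp

theorem derivative_coe_mul_expSer [CharZero F] (a : F) (A : F[X]) :
    PowerSeries.derivative F ((A : PowerSeries F) * expSer a) =
      (twD a A : PowerSeries F) * expSer a := by
  rw [Derivation.leibniz, PowerSeries.derivative_coe, derivative_expSer, twD, coe_add, coe_mul,
    coe_C, smul_eq_mul, smul_eq_mul]
  ring

theorem iterate_derivative_sum_expSer [CharZero F] {ι : Type*} [Fintype ι] (θ a : ι → F)
    (A : ι → F[X]) (t : ℕ) :
    (PowerSeries.derivative F)^[t]
        (∑ k, PowerSeries.C (θ k) * ((A k : PowerSeries F) * expSer (a k))) =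
      ∑ k, PowerSeries.C (θ k) *
        ((((twD (a k))^[t] (A k) : F[X]) : PowerSeries F) * expSer (a k)) := by
  induction t with
  | zero => simp
  | succ t ih =>
    rw [Function.iterate_succ_apply', ih, map_sum]
    refine Finset.sum_congr rfl fun k _ => ?_
    rw [Derivation.leibniz, derivative_coe_mul_expSer, PowerSeries.derivative_C, smul_zero,
      add_zero, smul_eq_mul, Function.iterate_succ_apply']

theorem taylor_twD (s a : F) (A : F[X]) : taylor s (twD a A) = twD a (taylor s A) := by
  simp [twD, taylor_apply, derivative_comp]

theorem taylor_iterate_twD (s a : F) (A : F[X]) (t : ℕ) :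
    taylor s ((twD a)^[t] A) = (twD a)^[t] (taylor s A) :=
  (Function.Semiconj.iterate_right (fun B => taylor_twD s a B) t) A

theorem natDegree_twD_le {R : Type*} [CommRing R] {N : ℕ} (a : R) {A : R[X]}
    (hA : A.natDegree ≤ N) : (twD a A).natDegree ≤ N :=
  natDegree_add_le_of_degree_le ((natDegree_derivative_le A).trans ((Nat.sub_le _ _).trans hA))
    ((natDegree_C_mul_le a A).trans hA)

theorem coeff_twD {R : Type*} [CommRing R] {N : ℕ} (a : R) {A : R[X]} (hA : A.natDegree ≤ N) :
    (twD a A).coeff N = a * A.coeff N := by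
  rw [twD, coeff_add, coeff_C_mul, coeff_derivative,
    coeff_eq_zero_of_natDegree_lt (Nat.lt_succ_of_le hA), zero_mul, zero_add]

theorem natDegree_iterate_twD_le {R : Type*} [CommRing R] {N : ℕ} (a : R) {A : R[X]}
    (hA : A.natDegree ≤ N) (t : ℕ) : ((twD a)^[t] A).natDegree ≤ N := by
  induction t with
  | zero => exact hA
  | succ t ih =>
    rw [Function.iterate_succ_apply']
    exact natDegree_twD_le a ih

theorem coeff_iterate_twD {R : Type*} [CommRing R] {N : ℕ} (a : R) {A : R[X]}
    (hA : A.natDegree ≤ N) (t : ℕ) : ((twD a)^[t] A).coeff N = a ^ t * A.coeff N := by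
  induction t with
  | zero => simp
  | succ t ih =>
    rw [Function.iterate_succ_apply', coeff_twD a (natDegree_iterate_twD_le a hA t), ih]
    ring

theorem natDegree_prod_le_sum {R ι : Type*} [CommRing R] (s : Finset ι) {f : ι → R[X]}
    {N : ι → ℕ} (h : ∀ i ∈ s, (f i).natDegree ≤ N i) :
    (∏ i ∈ s, f i).natDegree ≤ ∑ i ∈ s, N i :=
  (natDegree_prod_le s f).trans (Finset.sum_le_sum h)

theorem coeff_prod_sum_of_natDegree_le {R ι : Type*} [CommRing R] (s : Finset ι) {f : ι → R[X]}
    {N : ι → ℕ} (h : ∀ i ∈ s, (f i).natDegree ≤ N i) :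
    (∏ i ∈ s, f i).coeff (∑ i ∈ s, N i) = ∏ i ∈ s, (f i).coeff (N i) := by
  classical
  induction s using Finset.induction_on with
  | empty => simp
  | insert i s hi ih =>
    have hs : ∀ j ∈ s, (f j).natDegree ≤ N j := fun j hj => h j (Finset.mem_insert_of_mem hj)
    rw [Finset.prod_insert hi, Finset.sum_insert hi, Finset.prod_insert hi,
      coeff_mul_add_eq_of_natDegree_le (h i (Finset.mem_insert_self i s))
        (natDegree_prod_le_sum s hs), ih hs]

theorem natDegree_det_le_sum {R ι : Type*} [CommRing R] [Fintype ι] [DecidableEq ι]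
    {M : Matrix ι ι R[X]} {N : ι → ℕ} (h : ∀ t k, (M t k).natDegree ≤ N k) :
    M.det.natDegree ≤ ∑ k, N k := by
  rw [Matrix.det_apply]
  refine natDegree_sum_le_of_forall_le _ _ fun σ _ => ?_
  refine (natDegree_smul_le _ _).trans (natDegree_prod_le_sum _ fun k _ => h _ _)

theorem coeff_det_sum {R ι : Type*} [CommRing R] [Fintype ι] [DecidableEq ι]
    {M : Matrix ι ι R[X]} {N : ι → ℕ} (h : ∀ t k, (M t k).natDegree ≤ N k) :
    M.det.coeff (∑ k, N k) = (Matrix.of fun t k => (M t k).coeff (N k)).det := by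
  rw [Matrix.det_apply, Matrix.det_apply, finsetSum_coeff]
  refine Finset.sum_congr rfl fun σ _ => ?_
  rw [coeff_smul, coeff_prod_sum_of_natDegree_le _ fun k _ => h _ _]
  rfl

/-- The Wronskian of `A_k exp (a_k X)`, up to exponential factors. -/
noncomputable def wronskian {m : ℕ} (a : Fin m → F) (A : Fin m → F[X]) :
    Matrix (Fin m) (Fin m) F[X] :=
  Matrix.of fun t k => (twD (a k))^[t] (A k)

theorem natDegree_det_wronskian_le {m : ℕ} (a : Fin m → F) (A : Fin m → F[X]) :
    (wronskian a A).det.natDegree ≤ ∑ k, (A k).natDegree :=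
  natDegree_det_le_sum fun t k => natDegree_iterate_twD_le (a k) le_rfl t

/-- Each `twD (a k)` multiplies the coefficient in degree `deg (A k)` by `a k`. So the coefficient
of the determinant in degree `∑ deg (A k)` is the product of the leading coefficients times a
Vandermonde determinant in the distinct `a k`. -/
theorem det_wronskian_ne_zero {m : ℕ} {a : Fin m → F} (ha : Function.Injective a)
    {A : Fin m → F[X]} (hA : ∀ k, A k ≠ 0) : (wronskian a A).det ≠ 0 := by
  intro h0
  have h := coeff_det_sum (M := wronskian a A) (N := fun k => (A k).natDegree)
    fun t k => natDegree_iterate_twD_le (a k) le_rfl t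
  have h1 : (Matrix.of fun t k : Fin m => (wronskian a A t k).coeff (A k).natDegree) =
      Matrix.of fun t k => (A k).leadingCoeff * (Matrix.vandermonde a).transpose t k := by
    ext t k
    simp only [Matrix.of_apply, Matrix.transpose_apply, Matrix.vandermonde_apply, wronskian]
    rw [coeff_iterate_twD (a k) le_rfl, mul_comm, leadingCoeff]
  rw [h0, coeff_zero, h1, Matrix.det_mul_row, Matrix.det_transpose] at h
  refine mul_ne_zero (Finset.prod_ne_zero_iff.2 fun k _ => leadingCoeff_ne_zero.2 (hA k))
    (Matrix.det_vandermonde_ne_zero_iff.2 ha) h.symm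

theorem X_pow_dvd_of_iterate_derivative [CharZero F] {G : PowerSeries F} {N : ℕ}
    (h : ∀ n < N, PowerSeries.constantCoeff ((PowerSeries.derivative F)^[n] G) = 0) :
    PowerSeries.X ^ N ∣ G := by
  rw [PowerSeries.X_pow_dvd_iff]
  intro n hn
  have h1 := h n hn
  rw [PowerSeries.constantCoeff_iterate_derivative] at h1
  exact (mul_eq_zero.1 h1).resolve_left (Nat.cast_ne_zero.2 n.factorial_ne_zero)

theorem constantCoeff_coe_taylor_mul_expSer (s a : F) (A : F[X]) :
    PowerSeries.constantCoeff ((taylor s A : PowerSeries F) * expSer a) = A.eval s := by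
  rw [map_mul, ← PowerSeries.coeff_zero_eq_constantCoeff_apply,
    ← PowerSeries.coeff_zero_eq_constantCoeff_apply, coeff_coe, taylor_coeff_zero, expSer,
    PowerSeries.coeff_mk]
  simp

/-- If an exponential polynomial vanishes to high order at `s`, so does its Wronskian. -/
theorem X_sub_C_pow_dvd_det_wronskian [CharZero F] {m T : ℕ} (hm : 0 < m) {a : Fin m → F}
    {A : Fin m → F[X]} {s : F} {θ : Fin m → F} (hθ : ∀ k, θ k ≠ 0)
    (h : ∀ t < T, ∑ k, θ k * ((twD (a k))^[t] (A k)).eval s = 0) :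
    (X - C s) ^ (T + 1 - m) ∣ (wronskian a A).det := by
  set φ : F[X] →+* PowerSeries F :=
    (coeToPowerSeries.ringHom (R := F)).comp (taylorAlgHom s : F[X] →ₐ[F] F[X]).toRingHom with hφ
  have hφa : ∀ B, φ B = ((taylor s B : F[X]) : PowerSeries F) := fun B => rfl
  set v : Fin m → PowerSeries F := fun k => PowerSeries.C (θ k) * expSer (a k) with hv
  have hvu : ∀ k, IsUnit (v k) := fun k =>
    ((isUnit_iff_ne_zero.2 (hθ k)).map PowerSeries.C).mul (isUnit_expSer _)
  set M := φ.mapMatrix (wronskian a A) with hM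
  set G : PowerSeries F := ∑ k, PowerSeries.C (θ k) *
    (((taylor s (A k) : F[X]) : PowerSeries F) * expSer (a k)) with hG
  have hder : ∀ n, (PowerSeries.derivative F)^[n] G = ∑ k, PowerSeries.C (θ k) *
      (((taylor s ((twD (a k))^[n] (A k)) : F[X]) : PowerSeries F) * expSer (a k)) := fun n => by
    rw [hG, iterate_derivative_sum_expSer]
    simp_rw [taylor_iterate_twD]
  have hMv : ∀ t : Fin m, M.mulVec v t = (PowerSeries.derivative F)^[t] G := fun t => by
    rw [hder, Matrix.mulVec, dotProduct]
    refine Finset.sum_congr rfl fun k _ => ?_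
    rw [hM, RingHom.mapMatrix_apply, Matrix.map_apply, hφa, hv]
    simp only [wronskian, Matrix.of_apply]
    ring
  -- Row `t ≤ m - 1` already uses `t` derivatives, leaving vanishing of order at least `T + 1 - m`
  -- in every row.
  have hdvd : ∀ t : Fin m, PowerSeries.X ^ (T + 1 - m) ∣ M.mulVec v t := fun t => by
    rw [hMv]
    refine X_pow_dvd_of_iterate_derivative fun n hn => ?_
    rw [← Function.iterate_add_apply, hder, map_sum]
    rw [← h (n + t) (by have := t.2; omega)]
    refine Finset.sum_congr rfl fun k _ => ?_
    rw [map_mul, constantCoeff_coe_taylor_mul_expSer, PowerSeries.constantCoeff_C]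
  -- Cramer's rule: `adj(M) M v = det(M) v`, and the entries of `v` are units.
  have hdet : PowerSeries.X ^ (T + 1 - m) ∣ M.det * v ⟨0, hm⟩ := by
    have h1 : M.adjugate.mulVec (M.mulVec v) = M.det • v := by
      rw [Matrix.mulVec_mulVec, Matrix.adjugate_mul, Matrix.smul_mulVec, Matrix.one_mulVec]
    have h2 := congrFun h1 ⟨0, hm⟩
    rw [Pi.smul_apply, smul_eq_mul] at h2
    rw [← h2, Matrix.mulVec, dotProduct]
    exact Finset.dvd_sum fun t _ => (hdvd t).mul_left _
  rw [IsUnit.dvd_mul_right (hvu _), hM, ← RingHom.map_det, hφa, PowerSeries.X_pow_dvd_iff] at hdet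
  rw [X_sub_C_pow_dvd_iff, ← taylor_apply, X_pow_dvd_iff]
  intro d hd
  rw [← coeff_coe]
  exact hdet d hd

/-- Powers of `X - s` at distinct points are coprime, so their product divides the nonzero Wronskian
determinant; degrees are then compared. -/
theorem card_mul_le_of_vanishing [CharZero F] {m T : ℕ} (hm : 0 < m) {a : Fin m → F}
    (ha : Function.Injective a) {A : Fin m → F[X]} (hA : ∀ k, A k ≠ 0) (P : Finset F)
    {θ : F → Fin m → F} (hθ : ∀ s k, θ s k ≠ 0)
    (h : ∀ s ∈ P, ∀ t < T, ∑ k, θ s k * ((twD (a k))^[t] (A k)).eval s = 0) :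
    P.card * (T + 1 - m) ≤ ∑ k, (A k).natDegree := by
  have h1 : ∏ s ∈ P, (X - C s) ^ (T + 1 - m) ∣ (wronskian a A).det := by
    refine Finset.prod_dvd_of_coprime (fun s _ s' _ hss => ?_)
      fun s hs => X_sub_C_pow_dvd_det_wronskian hm (hθ s) (h s hs)
    exact (pairwise_coprime_X_sub_C (s := fun x : F => x) Function.injective_id hss).pow
  have h2 := natDegree_le_of_dvd h1 (det_wronskian_ne_zero ha hA)
  rw [natDegree_prod_of_monic _ _ fun s _ => (monic_X_sub_C s).pow _] at h2
  simp only [(monic_X_sub_C _).natDegree_pow, natDegree_X_sub_C, mul_one, Finset.sum_const,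
    smul_eq_mul] at h2
  exact h2.trans (natDegree_det_wronskian_le a A)

/-- Zero estimate for exponential polynomials. -/
theorem eq_zero_of_vanishing [CharZero F] {m T D : ℕ} {a : Fin m → F}
    (ha : Function.Injective a) {A : Fin m → F[X]} (hD : ∀ k, (A k).natDegree ≤ D) (P : Finset F)
    {θ : F → Fin m → F} (hθ : ∀ s k, θ s k ≠ 0)
    (h : ∀ s ∈ P, ∀ t < T, ∑ k, θ s k * ((twD (a k))^[t] (A k)).eval s = 0)
    (hcard : m * D < P.card * (T + 1 - m)) : ∀ k, A k = 0 := by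
  classical
  by_contra! hne
  obtain ⟨k₀, hk₀⟩ := hne
  -- The Wronskian is nonzero only if all its polynomials are, so the zero `A k` are discarded
  -- first.
  set I : Finset (Fin m) := Finset.univ.filter fun k => A k ≠ 0 with hI
  have hk₀I : k₀ ∈ I := by simp [hI, hk₀]
  set e : Fin I.card ≃ I := (I.equivFin).symm with he
  have hzero : ∀ (a : F) (t : ℕ), (twD a)^[t] 0 = 0 := fun a t =>
    Function.iterate_fixed (by simp [twD]) t
  have hle := card_mul_le_of_vanishing (T := T) (Finset.card_pos.2 ⟨k₀, hk₀I⟩)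
    (a := fun i => a (e i)) (A := fun i => A (e i)) (θ := fun s i => θ s (e i))
    (fun i j hij => e.injective (Subtype.ext (ha hij)))
    (fun i => (Finset.mem_filter.1 (e i).2).2) P (fun s i => hθ s _) (fun s hs t ht => by
      rw [← h s hs t ht, ← Finset.sum_subset (Finset.subset_univ I)]
      · rw [← Finset.sum_coe_sort I]
        exact Fintype.sum_equiv e _ _ fun i => rfl
      · intro k _ hk
        have hk0 : A k = 0 := by simpa [hI] using hk
        rw [hk0, hzero, eval_zero, mul_zero])
  have hIm : I.card ≤ m := (Finset.card_le_univ I).trans_eq (Fintype.card_fin m)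
  have h1 : ∑ i, (A (e i)).natDegree ≤ m * D := by
    refine (Finset.sum_le_sum fun i _ => hD (e i)).trans ?_
    rw [Finset.sum_const, Finset.card_univ, Fintype.card_fin, smul_eq_mul]
    exact Nat.mul_le_mul_right D hIm
  have h2 : P.card * (T + 1 - m) ≤ P.card * (T + 1 - I.card) :=
    Nat.mul_le_mul_left _ (Nat.sub_le_sub_left hIm _)
  omega

end ExpPoly

/-! ### Ultrametric smallness of interpolation determinants. -/

section DetBound

theorem sum_range_le_sum_of_injective {L : ℕ} {g : Fin L → ℕ} (hg : Function.Injective g) :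
    ∑ i ∈ Finset.range L, i ≤ ∑ i, g i := by
  have hinj : Function.Injective fun i : Fin L => (g i : ℤ) := Nat.cast_injective.comp hg
  have h := Finset.sum_range_le_sum (s := Finset.univ.image fun i : Fin L => (g i : ℤ)) (c := 0)
    (fun x hx => by
      obtain ⟨i, -, rfl⟩ := Finset.mem_image.1 hx
      exact Int.natCast_nonneg _)
  rw [Finset.card_image_of_injective _ hinj, Finset.sum_image fun _ _ _ _ h => hinj h,
    Finset.card_univ, Fintype.card_fin] at h
  zify
  simpa using h

variable {K : Type*} [NormedField K] [IsUltrametricDist K]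

theorem norm_det_le_one {L : ℕ} {M : Matrix (Fin L) (Fin L) K} (hM : ∀ i j, ‖M i j‖ ≤ 1) :
    ‖M.det‖ ≤ 1 := by
  rw [Matrix.det_apply']
  refine IsUltrametricDist.norm_sum_le_of_forall_le_of_nonneg zero_le_one fun σ _ => ?_
  have h : ‖((Equiv.Perm.sign σ : ℤ) : K)‖ = 1 := by
    rcases Int.units_eq_one_or (Equiv.Perm.sign σ) with h | h <;> simp [h]
  rw [norm_mul, h, one_mul, norm_prod]
  exact Finset.prod_le_one (fun _ _ => norm_nonneg _) fun i _ => hM _ _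

/-- Expand multilinearly in the rows. A choice of exponents with a repetition gives two equal rows
and contributes `0`; `L` distinct exponents add up to at least `0 + 1 + ... + (L - 1)`. This
exponent, quadratic in `L`, is the source of the gain. -/
theorem norm_det_finite_sum_le {L : ℕ} {c : Fin L → ℕ → K} {V : ℕ → Fin L → K} {η b : ℝ}
    (hη0 : 0 ≤ η) (hη1 : η ≤ 1) (hb : 0 < b) (hV : ∀ l r, ‖V l r‖ ≤ 1)
    (hc : ∀ i l, ‖c i l‖ ≤ η ^ l / b) (N : ℕ) :
    ‖(Matrix.of fun i r => ∑ l ∈ Finset.range N, c i l * V l r).det‖ ≤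
      η ^ (∑ i ∈ Finset.range L, i) / b ^ L := by
  have h1 : (Matrix.of fun i r => ∑ l ∈ Finset.range N, c i l * V l r).det =
      ∑ g : Fin L → Fin N, (∏ i, c i (g i)) * (Matrix.of fun i r => V (g i) r).det := by
    have h2 : (Matrix.of fun i r => ∑ l ∈ Finset.range N, c i l * V l r).det =
        (Matrix.detRowAlternating (n := Fin L) (R := K)).toMultilinearMap
          (fun i => ∑ l : Fin N, c i l • V l) := by
      congr 1
      ext i r
      simp [Finset.sum_range, Finset.sum_apply]
    rw [h2, MultilinearMap.map_sum]
    refine Finset.sum_congr rfl fun g _ => ?_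
    rw [MultilinearMap.map_smul_univ]
    rfl
  rw [h1]
  refine IsUltrametricDist.norm_sum_le_of_forall_le_of_nonneg (by positivity) fun g _ => ?_
  by_cases hg : Function.Injective g
  · rw [norm_mul, norm_prod]
    have h3 : ∏ i, ‖c i (g i)‖ ≤ η ^ (∑ i ∈ Finset.range L, i) / b ^ L := by
      calc ∏ i, ‖c i (g i)‖ ≤ ∏ i, η ^ (g i : ℕ) / b :=
            Finset.prod_le_prod (fun _ _ => norm_nonneg _) fun i _ => hc i _
        _ = η ^ (∑ i, (g i : ℕ)) / b ^ L := by
            rw [Finset.prod_div_distrib, Finset.prod_pow_eq_pow_sum, Finset.prod_const,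
              Finset.card_univ, Fintype.card_fin]
        _ ≤ _ := by
            refine div_le_div_of_nonneg_right ?_ (by positivity)
            exact pow_le_pow_of_le_one hη0 hη1
              (sum_range_le_sum_of_injective (Fin.val_injective.comp hg))
    exact (mul_le_of_le_one_right (Finset.prod_nonneg fun _ _ => norm_nonneg _)
      (norm_det_le_one fun i r => hV _ _)).trans h3
  · have h4 : (Matrix.of fun i r => V (g i) r).det = 0 := by
      refine (Matrix.detRowAlternating (n := Fin L) (R := K)).map_eq_zero_of_not_injective _
        fun h => hg fun i j hij => h ?_
      funext r
      change V (g i) r = V (g j) r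
      rw [hij]
    rw [h4, mul_zero, norm_zero]
    positivity

/-- The values at points of the unit disc of functions that are analytic on a larger disc have
small determinants. -/
theorem norm_det_le_of_hasSum {L : ℕ} {c : Fin L → ℕ → K} {V : ℕ → Fin L → K} {η b : ℝ}
    (hη0 : 0 ≤ η) (hη1 : η ≤ 1) (hb : 0 < b) (hV : ∀ l r, ‖V l r‖ ≤ 1)
    (hc : ∀ i l, ‖c i l‖ ≤ η ^ l / b) {M : Matrix (Fin L) (Fin L) K}
    (hM : ∀ i r, HasSum (fun l => c i l * V l r) (M i r)) :
    ‖M.det‖ ≤ η ^ (∑ i ∈ Finset.range L, i) / b ^ L := by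
  have h1 : Tendsto (fun N => Matrix.of fun i r => ∑ l ∈ Finset.range N, c i l * V l r) atTop
      (𝓝 M) :=
    tendsto_pi_nhds.2 fun i => tendsto_pi_nhds.2 fun r => (hM i r).tendsto_sum_nat
  have h2 := ((continuous_id.matrix_det (R := K)).tendsto M).comp h1
  exact le_of_tendsto h2.norm
    (Eventually.of_forall fun N => norm_det_finite_sum_le hη0 hη1 hb hV hc N)

end DetBound

/-! ### Taylor expansions of `X^j exp(kwX)` and of their derivatives. -/

section Values

variable {p}

open Polynomial in
theorem hasSum_coeff_coe_mul {F : Type*} [NormedField F] {g : PowerSeries F} {s v : F}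
    (hg : HasSum (fun l => PowerSeries.coeff l g * s ^ l) v) (A : F[X]) :
    HasSum (fun l => PowerSeries.coeff l ((A : PowerSeries F) * g) * s ^ l) (A.eval s * v) := by
  induction A using Polynomial.induction_on' with
  | add A B hA hB =>
    rw [eval_add, add_mul]
    refine (hA.add hB).congr_fun fun l => ?_
    rw [coe_add, add_mul, map_add, add_mul]
  | monomial n a =>
    have h : ∀ l, PowerSeries.coeff (l + n) ((monomial n a : PowerSeries F) * g) * s ^ (l + n) =
        a * s ^ n * (PowerSeries.coeff l g * s ^ l) := fun l => by
      rw [← C_mul_X_pow_eq_monomial, coe_mul, coe_C, coe_pow, coe_X, mul_assoc,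
        PowerSeries.coeff_C_mul, PowerSeries.coeff_X_pow_mul]
      ring
    have h0 : ∑ l ∈ Finset.range n,
        PowerSeries.coeff l ((monomial n a : PowerSeries F) * g) * s ^ l = 0 :=
      Finset.sum_eq_zero fun l hl => by
        rw [← C_mul_X_pow_eq_monomial, coe_mul, coe_C, coe_pow, coe_X, mul_assoc,
          PowerSeries.coeff_C_mul, PowerSeries.coeff_X_pow_mul',
          if_neg (not_le.2 (Finset.mem_range.1 hl)), mul_zero, zero_mul]
    have h1 := hg.mul_left (a * s ^ n)
    simp_rw [← h] at h1
    have h2 := (hasSum_nat_add_iff (f := fun l =>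
      PowerSeries.coeff l ((monomial n a : PowerSeries F) * g) * s ^ l) n).1 h1
    rw [h0, add_zero] at h2
    rwa [eval_monomial]

theorem hasSum_coeff_expSer {a s : ℚ_[p]} (h : ‖a * s‖ * rho p < 1) :
    HasSum (fun l => PowerSeries.coeff l (expSer a) * s ^ l) (NormedSpace.exp (a * s)) := by
  have := NormedSpace.expSeries_div_hasSum_exp_of_mem_ball ℚ_[p] (a * s) (mem_eball_radius h)
  refine this.congr_fun fun l => ?_
  rw [expSer, PowerSeries.coeff_mk, mul_pow]
  ring

theorem norm_natCast_padic_le_one (n : ℕ) : ‖(n : ℚ_[p])‖ ≤ 1 := by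
  exact_mod_cast Padic.norm_int_le_one (n : ℤ)

theorem norm_mul_natCast_mul_rho_lt {w : ℚ_[p]} (hw : ‖w‖ * rho p < 1) (n : ℕ) :
    ‖(n : ℚ_[p]) * w‖ * rho p < 1 := by
  refine lt_of_le_of_lt (mul_le_mul_of_nonneg_right ?_ (rho_pos p).le) hw
  rw [norm_mul]
  exact mul_le_of_le_one_left (norm_nonneg _) (norm_natCast_padic_le_one n)

/-- The Taylor coefficients of `X ^ j * exp (k w X)`. -/
noncomputable def monoExpCoeff (w : ℚ_[p]) (j k l : ℕ) : ℚ_[p] :=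
  PowerSeries.coeff l
    (((Polynomial.X ^ j : Polynomial ℚ_[p]) : PowerSeries ℚ_[p]) * expSer ((k : ℚ_[p]) * w))

/-- The coefficient is `(k w)^(l - j) / (l - j)!`, of norm at most `η^(l - j)` with `η = ‖w‖ * rho p
< 1`. Dividing by `η^J` makes the bound uniform in `j ≤ J`. -/
theorem norm_monoExpCoeff_le {w : ℚ_[p]} (hw0 : w ≠ 0) (hw : ‖w‖ * rho p < 1) {j J : ℕ}
    (hj : j ≤ J) (k l : ℕ) :
    ‖monoExpCoeff w j k l‖ ≤ (‖w‖ * rho p) ^ l / (‖w‖ * rho p) ^ J := by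
  have hη : 0 < ‖w‖ * rho p := mul_pos (norm_pos_iff.2 hw0) (rho_pos p)
  rw [monoExpCoeff, Polynomial.coe_pow, Polynomial.coe_X, PowerSeries.coeff_X_pow_mul']
  split_ifs with h
  · have h1 : ‖PowerSeries.coeff (l - j) (expSer ((k : ℚ_[p]) * w))‖ ≤
        (‖w‖ * rho p) ^ (l - j) := by
      rw [expSer, PowerSeries.coeff_mk, norm_div, norm_pow, norm_mul, div_eq_mul_inv,
        mul_pow _ _ (l - j),
        mul_pow]
      have := inv_norm_factorial_le p (l - j)
      have h2 : ‖(k : ℚ_[p])‖ ^ (l - j) ≤ 1 :=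
        pow_le_one₀ (norm_nonneg _) (norm_natCast_padic_le_one k)
      refine mul_le_mul ?_ this (by positivity) (by positivity)
      exact mul_le_of_le_one_left (by positivity) h2
    rw [le_div_iff₀ (by positivity)]
    calc _ ≤ (‖w‖ * rho p) ^ (l - j) * (‖w‖ * rho p) ^ j := by
          refine mul_le_mul h1 (pow_le_pow_of_le_one hη.le hw.le hj) (by positivity)
            (by positivity)
      _ = _ := by rw [← pow_add, Nat.sub_add_cancel h]
  · rw [norm_zero]
    positivity

/-- The `t`-th derivative of `X ^ l` at the natural number `s`. -/
def powDeriv (l t s : ℕ) : ℕ := if t ≤ l then (l - t + 1).ascFactorial t * s ^ (l - t) else 0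

/-- Termwise differentiation separates the function (through its Taylor coefficients) from the point
and the order (through the integers `powDeriv`, of norm at most `1`), as the determinant bound
requires. -/
theorem hasSum_monoExpCoeff {w : ℚ_[p]} (hw : ‖w‖ * rho p < 1) (j k t s : ℕ) :
    HasSum (fun l => monoExpCoeff w j k l * (powDeriv l t s : ℚ_[p]))
      (((twD ((k : ℚ_[p]) * w))^[t] (Polynomial.X ^ j)).eval (s : ℚ_[p]) *
        NormedSpace.exp w ^ (k * s)) := by
  have h1 := hasSum_coeff_coe_mul (hasSum_coeff_expSer (a := (k : ℚ_[p]) * w) (s := s) (by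
    have := norm_mul_natCast_mul_rho_lt hw (k * s)
    rwa [Nat.cast_mul, mul_right_comm] at this))
    ((twD ((k : ℚ_[p]) * w))^[t] (Polynomial.X ^ j))
  have h2 : NormedSpace.exp ((k : ℚ_[p]) * w * s) = NormedSpace.exp w ^ (k * s) := by
    rw [← exp_natCast_mul hw, Nat.cast_mul, mul_right_comm]
  have h3 : ((((twD ((k : ℚ_[p]) * w))^[t] (Polynomial.X ^ j) : Polynomial ℚ_[p]) :
      PowerSeries ℚ_[p]) * expSer ((k : ℚ_[p]) * w)) = (PowerSeries.derivative ℚ_[p])^[t]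
      (((Polynomial.X ^ j : Polynomial ℚ_[p]) : PowerSeries ℚ_[p]) *
        expSer ((k : ℚ_[p]) * w)) := by
    have := iterate_derivative_sum_expSer (ι := Unit) (fun _ => (1 : ℚ_[p]))
      (fun _ => (k : ℚ_[p]) * w) (fun _ => Polynomial.X ^ j) t
    simpa using this.symm
  rw [h2, h3] at h1
  have h4 : ∀ l, PowerSeries.coeff l ((PowerSeries.derivative ℚ_[p])^[t]
      (((Polynomial.X ^ j : Polynomial ℚ_[p]) : PowerSeries ℚ_[p]) *
        expSer ((k : ℚ_[p]) * w))) * (s : ℚ_[p]) ^ l =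
      monoExpCoeff w j k (l + t) * (powDeriv (l + t) t s : ℚ_[p]) := fun l => by
    rw [PowerSeries.coeff_iterate_derivative, monoExpCoeff, powDeriv, if_pos (Nat.le_add_left t l),
      Nat.add_sub_cancel]
    push_cast
    ring
  simp_rw [h4] at h1
  have h5 := (hasSum_nat_add_iff (f := fun l =>
    monoExpCoeff w j k l * (powDeriv l t s : ℚ_[p])) t).1 h1
  have h6 : ∑ l ∈ Finset.range t, monoExpCoeff w j k l * (powDeriv l t s : ℚ_[p]) = 0 :=
    Finset.sum_eq_zero fun l hl => by
      rw [powDeriv, if_neg (not_le.2 (Finset.mem_range.1 hl)), Nat.cast_zero, mul_zero]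
  rwa [h6, add_zero] at h5

end Values

/-! ### Lower bound for nonzero algebraic integers. -/

section Liouville

variable {p}

theorem norm_le_one_of_isIntegral {x : ℚ_[p]} (hx : IsIntegral ℤ x) : ‖x‖ ≤ 1 := by
  have h : IsIntegral ℤ_[p] x := hx.tower_top
  obtain ⟨y, rfl⟩ := IsIntegrallyClosed.isIntegral_iff.1 h
  exact PadicInt.norm_le_one y

/-- A Liouville type inequality. -/
theorem one_le_norm_mul_of_isIntegral {K : Type*} [Field K] [NumberField K] (ι : K →+* ℚ_[p])
    {x : K} (hx0 : x ≠ 0) (hx : IsIntegral ℤ x) {H : ℝ} (hH : ∀ φ : K →+* ℂ, ‖φ x‖ ≤ H) :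
    1 ≤ ‖ι x‖ * (max H 1 ^ Module.finrank ℚ K *
      ((Module.finrank ℚ K).choose (Module.finrank ℚ K / 2) : ℝ)) := by
  set B : ℝ := max H 1 ^ Module.finrank ℚ K *
      ((Module.finrank ℚ K).choose (Module.finrank ℚ K / 2) : ℝ) with hB
  have hmin := minpoly.isIntegrallyClosed_eq_field_fractions' ℚ hx
  set a : ℤ := (minpoly ℤ x).coeff 0 with ha
  have ha0 : a ≠ 0 := fun h0 => by
    refine minpoly.coeff_zero_ne_zero (A := ℚ) hx.tower_top hx0 ?_
    rw [hmin, Polynomial.coeff_map, ← ha, h0, map_zero]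
  have h1 : |(a : ℝ)| ≤ B := by
    have := NumberField.Embeddings.coeff_bdd_of_norm_le (A := ℂ) hH 0
    rwa [hmin, Polynomial.coeff_map, ← ha, eq_intCast, ← Rat.norm_cast_real, Rat.cast_intCast,
      Real.norm_eq_abs] at this
  -- The minimal polynomial shows that `x` divides its constant term `a` with an integral quotient,
  -- and integral elements of `ℚ_[p]` have norm at most `1`.
  have h2 : ‖(a : ℚ_[p])‖ ≤ ‖ι x‖ := by
    have h3 : x * Polynomial.aeval x (minpoly ℤ x).divX + a = 0 := by
      have h4 := congrArg (Polynomial.aeval x) (Polynomial.X_mul_divX_add (minpoly ℤ x))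
      rw [minpoly.aeval] at h4
      simpa using h4
    have h5 : (a : ℚ_[p]) = -(ι x * ι (Polynomial.aeval x (minpoly ℤ x).divX)) := by
      have := congrArg ι h3
      rw [map_add, map_mul, map_intCast, map_zero] at this
      linear_combination this
    have h6 : IsIntegral ℤ (Polynomial.aeval x (minpoly ℤ x).divX) :=
      IsIntegral.of_mem_of_fg _ hx.fg_adjoin_singleton _
        (Polynomial.aeval_mem_adjoin_singleton ℤ x)
    have h7 : IsIntegral ℤ (ι (Polynomial.aeval x (minpoly ℤ x).divX)) :=
      h6.map ι.toIntAlgHom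
    rw [h5, norm_neg, norm_mul]
    exact mul_le_of_le_one_right (norm_nonneg _) (norm_le_one_of_isIntegral h7)
  -- For a nonzero integer, the power of `p` dividing it is at most its absolute value.
  have h3 : 1 ≤ ‖(a : ℚ_[p])‖ * |(a : ℝ)| := by
    have hnorm : ‖(a : ℚ_[p])‖ = (p : ℝ) ^ (-(padicValInt p a : ℤ)) := by
      rw [Padic.norm_eq_zpow_neg_valuation (Int.cast_ne_zero.2 ha0), Padic.valuation_intCast]
    have hle : ((p : ℝ) ^ padicValInt p a) ≤ |(a : ℝ)| := by
      have h8 : ((p : ℤ) ^ padicValInt p a) ≤ |a| :=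
        Int.le_of_dvd (abs_pos.2 ha0) ((dvd_abs _ _).2 (padicValInt_dvd a))
      exact_mod_cast h8
    have hpos : (0 : ℝ) < (p : ℝ) ^ padicValInt p a := pow_pos (prime_pos_real p) _
    rw [hnorm, zpow_neg, zpow_natCast]
    calc (1 : ℝ) = ((p : ℝ) ^ padicValInt p a)⁻¹ * (p : ℝ) ^ padicValInt p a :=
          (inv_mul_cancel₀ hpos.ne').symm
      _ ≤ _ := mul_le_mul_of_nonneg_left hle (inv_nonneg.2 hpos.le)
  exact h3.trans (mul_le_mul h2 h1 (abs_nonneg _) (norm_nonneg _))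

end Liouville

/-! ### Archimedean size of the polynomial parts of the matrix entries. -/

section IntegerValues

open Polynomial

/-- The values at natural numbers of the derivatives of `X ^ j * exp (k W X)`, up to the
exponential factor. -/
noncomputable def twVal (W j k t s : ℕ) : ℤ :=
  ((twD ((k : ℤ) * W))^[t] (X ^ j)).eval (s : ℤ)

theorem map_twD {R S : Type*} [CommRing R] [CommRing S] (f : R →+* S) (a : R) (A : R[X]) :
    (twD a A).map f = twD (f a) (A.map f) := by
  simp [twD, derivative_map]

theorem map_iterate_twD {R S : Type*} [CommRing R] [CommRing S] (f : R →+* S) (a : R) (A : R[X])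
    (t : ℕ) : ((twD a)^[t] A).map f = (twD (f a))^[t] (A.map f) :=
  (Function.Semiconj.iterate_right (f := fun B : R[X] => B.map f) (fun B => map_twD f a B) t) A

theorem eval_iterate_twD_natCast {R : Type*} [CommRing R] (W j k t s : ℕ) :
    ((twD ((k : R) * W))^[t] (X ^ j)).eval (s : R) = (twVal W j k t s : R) := by
  have h := map_iterate_twD (Int.castRingHom R) ((k : ℤ) * W) (X ^ j) t
  simp only [map_mul, map_natCast, Polynomial.map_pow, map_X] at h
  rw [← h, twVal, eval_map, ← map_natCast (Int.castRingHom R) s, eval₂_at_apply, eq_intCast]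

/-- The sum of the absolute values of the terms of degree at most `J` of `A` at `x`. -/
def termSum (J : ℕ) (x : ℤ) (A : ℤ[X]) : ℤ := ∑ i ∈ Finset.range (J + 1), |A.coeff i| * x ^ i

/-- Differentiation costs a factor at most `J`, as `x ≥ 1` absorbs the lost power of `x`; the twist
costs `a`. Unlike the value at a point, this majorant can be iterated. -/
theorem termSum_twD_le {J : ℕ} {x a : ℤ} (hx : 1 ≤ x) (ha : 0 ≤ a) {A : ℤ[X]}
    (hA : A.natDegree ≤ J) : termSum J x (twD a A) ≤ (J + a) * termSum J x A := by
  have hx0 : 0 ≤ x := zero_le_one.trans hx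
  have h1 : ∑ i ∈ Finset.range (J + 1), (|A.coeff (i + 1)| * (i + 1)) * x ^ i ≤
      J * termSum J x A := by
    rw [Finset.sum_range_succ, coeff_eq_zero_of_natDegree_lt (Nat.lt_succ_of_le hA), abs_zero,
      zero_mul, zero_mul, add_zero, termSum, Finset.sum_range_succ', mul_add, Finset.mul_sum]
    refine le_add_of_le_of_nonneg (Finset.sum_le_sum fun i hi => ?_) (by positivity)
    have h2 : ((i : ℤ) + 1) ≤ J := by exact_mod_cast Finset.mem_range.1 hi
    have h3 : x ^ i ≤ x ^ (i + 1) := pow_le_pow_right₀ hx (Nat.le_succ i)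
    calc |A.coeff (i + 1)| * (i + 1) * x ^ i ≤ |A.coeff (i + 1)| * J * x ^ (i + 1) := by gcongr
      _ = _ := by ring
  calc termSum J x (twD a A)
      ≤ ∑ i ∈ Finset.range (J + 1),
          ((|A.coeff (i + 1)| * (i + 1)) * x ^ i + a * (|A.coeff i| * x ^ i)) := by
        refine Finset.sum_le_sum fun i _ => ?_
        have h4 : |(twD a A).coeff i| ≤ |A.coeff (i + 1)| * (i + 1) + a * |A.coeff i| := by
          rw [twD, coeff_add, coeff_C_mul, coeff_derivative]
          refine (abs_add_le _ _).trans_eq ?_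
          rw [abs_mul, abs_mul, abs_of_nonneg ha, abs_of_nonneg (by positivity : (0 : ℤ) ≤ i + 1)]
        calc _ ≤ (|A.coeff (i + 1)| * (i + 1) + a * |A.coeff i|) * x ^ i :=
              mul_le_mul_of_nonneg_right h4 (pow_nonneg hx0 i)
          _ = _ := by ring
    _ ≤ J * termSum J x A + a * termSum J x A := by
        rw [Finset.sum_add_distrib, ← Finset.mul_sum]
        exact add_le_add_left h1 _
    _ = _ := by ring

theorem termSum_iterate_twD_le {J : ℕ} {x a : ℤ} (hx : 1 ≤ x) (ha : 0 ≤ a) {A : ℤ[X]}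
    (hA : A.natDegree ≤ J) (t : ℕ) :
    termSum J x ((twD a)^[t] A) ≤ (J + a) ^ t * termSum J x A := by
  induction t with
  | zero => simp
  | succ t ih =>
    rw [Function.iterate_succ_apply', pow_succ', mul_assoc]
    exact (termSum_twD_le hx ha (natDegree_iterate_twD_le a hA t)).trans
      (mul_le_mul_of_nonneg_left ih (by positivity))

theorem abs_eval_le_termSum {J : ℕ} {x s : ℤ} (hs0 : 0 ≤ s) (hsx : s ≤ x) {A : ℤ[X]}
    (hA : A.natDegree ≤ J) : |A.eval s| ≤ termSum J x A := by
  rw [eval_eq_sum_range' (Nat.lt_succ_of_le hA)]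
  refine (Finset.abs_sum_le_sum_abs _ _).trans (Finset.sum_le_sum fun i _ => ?_)
  rw [abs_mul, abs_pow, abs_of_nonneg hs0]
  exact mul_le_mul_of_nonneg_left (pow_le_pow_left₀ hs0 hsx i) (abs_nonneg _)

theorem abs_twVal_le {W J T n j k t s : ℕ} (hn : 1 ≤ n) (hW : 1 ≤ W) (hj : j ≤ J) (hk : k ≤ n)
    (ht : t ≤ T) (hs : s ≤ n) : |twVal W j k t s| ≤ (J + n * W : ℤ) ^ T * n ^ J := by
  have hdeg : (X ^ j : ℤ[X]).natDegree ≤ J := by rwa [natDegree_X_pow]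
  have hn1 : (1 : ℤ) ≤ n := by exact_mod_cast hn
  have hW1 : (1 : ℤ) ≤ W := by exact_mod_cast hW
  have h1 : termSum J n (X ^ j) = (n : ℤ) ^ j := by
    rw [termSum, Finset.sum_eq_single j]
    · simp
    · intro i _ hij
      simp [coeff_X_pow, hij]
    · intro h
      exact absurd (Finset.mem_range.2 (Nat.lt_succ_of_le hj)) h
  have h2 : (J + k * W : ℤ) ≤ J + n * W := by gcongr
  have h3 : (1 : ℤ) ≤ J + n * W := by
    have : (1 : ℤ) ≤ n * W := one_le_mul_of_one_le_of_one_le hn1 hW1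
    have : (0 : ℤ) ≤ J := Int.natCast_nonneg _
    omega
  calc |twVal W j k t s| ≤ termSum J n ((twD ((k : ℤ) * W))^[t] (X ^ j)) :=
        abs_eval_le_termSum (Int.natCast_nonneg _) (by exact_mod_cast hs)
          (natDegree_iterate_twD_le _ hdeg t)
    _ ≤ (J + k * W : ℤ) ^ t * (n : ℤ) ^ j := by
        rw [← h1]
        exact termSum_iterate_twD_le hn1 (by positivity) hdeg t
    _ ≤ (J + n * W : ℤ) ^ T * n ^ J :=
        mul_le_mul ((pow_le_pow_left₀ (by positivity) h2 t).trans (pow_le_pow_right₀ h3 ht))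
          (pow_le_pow_right₀ hn1 hj) (by positivity) (by positivity)

end IntegerValues

/-! ### Existence of a nonzero interpolation determinant. -/

section RowSelection

open Polynomial

variable {F : Type*} [Field F]

theorem iterate_twD_sum {ι : Type*} [Fintype ι] (a : F) (c : ι → F) (B : ι → F[X]) (t : ℕ) :
    (twD a)^[t] (∑ j, C (c j) * B j) = ∑ j, C (c j) * (twD a)^[t] (B j) := by
  induction t with
  | zero => rfl
  | succ t ih =>
    rw [Function.iterate_succ_apply', ih, twD, derivative_sum, Finset.mul_sum,
      ← Finset.sum_add_distrib]
    refine Finset.sum_congr rfl fun j _ => ?_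
    rw [Function.iterate_succ_apply', derivative_C_mul, twD]
    ring

/-- The values at `s` of the `t`-th derivatives of the functions `X ^ j * exp (k w X)`, where
`θ = exp w`. -/
noncomputable def expVal (w θ : F) (j k t s : ℕ) : F :=
  ((twD ((k : F) * w))^[t] (X ^ j)).eval (s : F) * θ ^ (k * s)

/-- A linear form killing all these vectors gives the coefficients of an exponential polynomial that
vanishes to order `T` at `n` points; the zero estimate makes it zero. -/
theorem span_expVal_eq_top [CharZero F] {w θ : F} (hw : w ≠ 0) (hθ : θ ≠ 0) {n J T : ℕ}
    (hcard : n * J < n * (T + 1 - n)) :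
    Submodule.span F {v : Fin ((J + 1) * n) → F | ∃ s t : ℕ, s < n ∧ t < T ∧
      v = fun i => expVal w θ i.divNat i.modNat t s} = ⊤ := by
  by_contra hne
  obtain ⟨f, hf0, hf⟩ := Submodule.exists_le_ker_of_lt_top _ (lt_top_iff_ne_top.2 hne)
  set c : Fin ((J + 1) * n) → F := fun i => f fun j => if i = j then 1 else 0 with hc
  have hfc : ∀ v, f v = ∑ i, v i * c i := fun v => LinearMap.pi_apply_eq_sum_univ f v
  set A : Fin n → F[X] := fun k => ∑ j : Fin (J + 1), C (c (finProdFinEquiv (j, k))) * X ^ (j : ℕ)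
    with hA
  have hAcoeff : ∀ k (j : Fin (J + 1)), (A k).coeff j = c (finProdFinEquiv (j, k)) := fun k j => by
    rw [hA, finsetSum_coeff, Finset.sum_eq_single j]
    · simp
    · intro i _ hij
      rw [coeff_C_mul, coeff_X_pow, if_neg (fun h => hij (Fin.ext h).symm), mul_zero]
    · intro h
      exact absurd (Finset.mem_univ j) h
  have hAdeg : ∀ k, (A k).natDegree ≤ J := fun k =>
    natDegree_sum_le_of_forall_le _ _ fun j _ =>
      (natDegree_C_mul_X_pow_le _ _).trans (Nat.lt_succ_iff.1 j.2)
  -- The zero estimate indexes its weights by points of `F`, while the exponent of `θ` needs the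
  -- natural number behind the point.
  have hinv : ∀ s : ℕ, Function.invFun (Nat.cast : ℕ → F) s = s := fun s =>
    Function.leftInverse_invFun Nat.cast_injective s
  have hzero := eq_zero_of_vanishing (T := T) (a := fun k : Fin n => (k : F) * w) (A := A) (D := J)
    (fun k l hkl => Fin.ext (Nat.cast_injective (mul_right_cancel₀ hw hkl))) hAdeg
    ((Finset.range n).map ⟨(Nat.cast : ℕ → F), Nat.cast_injective⟩)
    (θ := fun s k => θ ^ ((k : ℕ) * Function.invFun (Nat.cast : ℕ → F) s))
    (fun s k => pow_ne_zero _ hθ) (fun s' hs' t ht => by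
      obtain ⟨s, hs, rfl⟩ := Finset.mem_map.1 hs'
      have h1 := hf (Submodule.subset_span ⟨s, t, Finset.mem_range.1 hs, ht, rfl⟩)
      rw [LinearMap.mem_ker, hfc, ← finProdFinEquiv.sum_comp, Fintype.sum_prod_type_right] at h1
      rw [← h1]
      refine Finset.sum_congr rfl fun k _ => ?_
      simp only [Function.Embedding.coeFn_mk, hinv]
      rw [hA, iterate_twD_sum, eval_finsetSum, Finset.mul_sum]
      refine Finset.sum_congr rfl fun j _ => ?_
      have h2 : (finProdFinEquiv (j, k)).divNat = j ∧ (finProdFinEquiv (j, k)).modNat = k := by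
        have := finProdFinEquiv.symm_apply_apply (j, k)
        exact Prod.ext_iff.1 this
      rw [h2.1, h2.2, eval_mul, eval_C, expVal]
      ring)
    (by rwa [Finset.card_map, Finset.card_range])
  refine hf0 (LinearMap.ext fun v => ?_)
  rw [hfc, LinearMap.zero_apply]
  refine Finset.sum_eq_zero fun i _ => ?_
  obtain ⟨⟨j, k⟩, rfl⟩ := finProdFinEquiv.surjective i
  rw [← hAcoeff, hzero, coeff_zero, mul_zero]

theorem exists_det_expVal_ne_zero [CharZero F] {w θ : F} (hw : w ≠ 0) (hθ : θ ≠ 0) {n J T : ℕ}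
    (hcard : n * J < n * (T + 1 - n)) :
    ∃ s t : Fin ((J + 1) * n) → ℕ, (∀ r, s r < n) ∧ (∀ r, t r < T) ∧
      (Matrix.of fun i r : Fin ((J + 1) * n) =>
        expVal w θ i.divNat i.modNat (t r) (s r)).det ≠ 0 := by
  have hspan := span_expVal_eq_top hw hθ hcard
  obtain ⟨f, hf, -, hlin⟩ := Submodule.exists_fun_fin_finrank_span_eq F
    {v : Fin ((J + 1) * n) → F | ∃ s t : ℕ, s < n ∧ t < T ∧
      v = fun i => expVal w θ i.divNat i.modNat t s}
  have hrank : Module.finrank F (Submodule.span F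
      {v : Fin ((J + 1) * n) → F | ∃ s t : ℕ, s < n ∧ t < T ∧
        v = fun i => expVal w θ i.divNat i.modNat t s}) = (J + 1) * n := by
    rw [hspan, finrank_top, Module.finrank_fin_fun]
  set e := finCongr hrank.symm with he
  choose s t hs ht hv using fun r => hf (e r)
  refine ⟨s, t, hs, ht, ?_⟩
  set M : Matrix (Fin ((J + 1) * n)) (Fin ((J + 1) * n)) F := Matrix.of fun i r =>
    expVal w θ i.divNat i.modNat (t r) (s r) with hM
  have h1 : M.transpose.row = f ∘ e := by
    funext r
    rw [Function.comp_apply, hv]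
    rfl
  have h2 : IsUnit M.transpose := by
    rw [← Matrix.linearIndependent_rows_iff_isUnit, h1]
    exact hlin.comp _ e.injective
  rw [← Matrix.det_transpose]
  exact ((Matrix.isUnit_iff_isUnit_det _).1 h2).ne_zero

end RowSelection

/-! ### Upper and lower bounds for the interpolation determinants. -/

section Transcendence

variable {p}

/-- The upper bound for determinants of values of the functions `X ^ j * exp (k w X)`. -/
theorem norm_det_expVal_le {w : ℚ_[p]} (hw0 : w ≠ 0) (hw : ‖w‖ * rho p < 1) {n J : ℕ}
    (s t : Fin ((J + 1) * n) → ℕ) :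
    ‖(Matrix.of fun i r : Fin ((J + 1) * n) =>
      expVal w (NormedSpace.exp w) i.divNat i.modNat (t r) (s r)).det‖ ≤
      (‖w‖ * rho p) ^ (∑ i ∈ Finset.range ((J + 1) * n), i) /
        ((‖w‖ * rho p) ^ J) ^ ((J + 1) * n) := by
  have hη : 0 < ‖w‖ * rho p := mul_pos (norm_pos_iff.2 hw0) (rho_pos p)
  exact norm_det_le_of_hasSum (V := fun l r => (powDeriv l (t r) (s r) : ℚ_[p])) hη.le hw.le
    (pow_pos hη J) (fun l r => norm_natCast_padic_le_one _)
    (fun i l => norm_monoExpCoeff_le hw0 hw (Nat.lt_succ_iff.1 i.divNat.2) i.modNat l)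
    fun i r => hasSum_monoExpCoeff hw _ _ _ _

open IntermediateField in
/-- The arithmetic lower bound for determinants of values of the functions
`X ^ j * exp (k W X)`, when `θ` is algebraic. -/
theorem exists_lower_bound {W : ℕ} (hW : 1 ≤ W) {θ : ℚ_[p]} (hθ : IsAlgebraic ℚ θ) :
    ∃ (d : ℕ) (c H : ℝ), 1 ≤ c ∧ 1 ≤ H ∧ ∀ (n J T : ℕ) (s t : Fin ((J + 1) * n) → ℕ), 1 ≤ n →
      (∀ r, s r < n) → (∀ r, t r < T) →
      (Matrix.of fun i r : Fin ((J + 1) * n) =>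
        expVal (W : ℚ_[p]) θ i.divNat i.modNat (t r) (s r)).det ≠ 0 →
      1 ≤ ‖(Matrix.of fun i r : Fin ((J + 1) * n) =>
        expVal (W : ℚ_[p]) θ i.divNat i.modNat (t r) (s r)).det‖ *
        ((((J + 1) * n).factorial : ℝ) *
          (((J + n * W : ℝ) ^ T * (n : ℝ) ^ J) * H ^ (n * n)) ^ ((J + 1) * n)) ^ d * c := by
  have : FiniteDimensional ℚ ℚ⟮θ⟯ := adjoin.finiteDimensional hθ.isIntegral
  have : NumberField ℚ⟮θ⟯ := { to_charZero := inferInstance, to_finiteDimensional := inferInstance }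
  set g : ℚ⟮θ⟯ := AdjoinSimple.gen ℚ θ
  have hgθ : algebraMap ℚ⟮θ⟯ ℚ_[p] g = θ := AdjoinSimple.algebraMap_gen ℚ θ
  have hgalg : IsAlgebraic ℤ g :=
    (IsFractionRing.isAlgebraic_iff ℤ ℚ ℚ⟮θ⟯).2 (Algebra.IsAlgebraic.isAlgebraic g)
  -- `a` is a denominator of `θ`. The powers of `θ` in the entries have exponent `k s ≤ n * n`, so
  -- `a ^ (n * n)` clears every entry.
  obtain ⟨a, ha0, haint⟩ := hgalg.exists_integral_multiple
  rw [zsmul_eq_mul] at haint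
  obtain ⟨H₁, hH₁⟩ := (Set.finite_range fun φ : ℚ⟮θ⟯ →+* ℂ => ‖φ g‖).bddAbove
  have ha1 : (1 : ℝ) ≤ |(a : ℝ)| := by exact_mod_cast Int.one_le_abs ha0
  refine ⟨Module.finrank ℚ ℚ⟮θ⟯,
    ((Module.finrank ℚ ℚ⟮θ⟯).choose (Module.finrank ℚ ℚ⟮θ⟯ / 2) : ℝ), |(a : ℝ)| * max 1 H₁,
    ?_, one_le_mul_of_one_le_of_one_le ha1 (le_max_left _ _), fun n J T s t hn hs ht hdet => ?_⟩
  · exact_mod_cast Nat.choose_pos (Nat.div_le_self _ 2)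
  set Δ := (Matrix.of fun i r : Fin ((J + 1) * n) =>
    expVal (W : ℚ_[p]) θ i.divNat i.modNat (t r) (s r)).det
  set X : Matrix (Fin ((J + 1) * n)) (Fin ((J + 1) * n)) ℚ⟮θ⟯ :=
    Matrix.of fun i r : Fin ((J + 1) * n) =>
    (a : ℚ⟮θ⟯) ^ (n * n) *
      ((twVal W i.divNat i.modNat (t r) (s r) : ℚ⟮θ⟯) * g ^ ((i.modNat : ℕ) * s r)) with hX
  have hks : ∀ i r : Fin ((J + 1) * n), (i.modNat : ℕ) * s r ≤ n * n := fun i r =>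
    Nat.mul_le_mul i.modNat.2.le (hs r).le
  set H₂ : ℝ := ((J + n * W : ℝ) ^ T * (n : ℝ) ^ J) * (|(a : ℝ)| * max 1 H₁) ^ (n * n) with hH₂
  have hιX : algebraMap ℚ⟮θ⟯ ℚ_[p] X.det = ((a : ℚ_[p]) ^ (n * n)) ^ ((J + 1) * n) * Δ := by
    have h1 : (algebraMap ℚ⟮θ⟯ ℚ_[p]).mapMatrix X = (a : ℚ_[p]) ^ (n * n) •
        (Matrix.of fun i r : Fin ((J + 1) * n) =>
          expVal (W : ℚ_[p]) θ i.divNat i.modNat (t r) (s r)) := by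
      ext i r
      simp only [hX, RingHom.mapMatrix_apply, Matrix.map_apply, Matrix.of_apply, Matrix.smul_apply,
        smul_eq_mul, map_mul, map_pow, map_intCast, hgθ, expVal, eval_iterate_twD_natCast]
    rw [RingHom.map_det, h1, Matrix.det_smul, Fintype.card_fin]
  have hX0 : X.det ≠ 0 := by
    intro h0
    rw [h0, map_zero] at hιX
    exact mul_ne_zero (pow_ne_zero _ (pow_ne_zero _ (Int.cast_ne_zero.2 ha0))) hdet hιX.symm
  have hXint : IsIntegral ℤ X.det := by
    refine IsIntegral.det fun i r => ?_
    have h1 : X i r = (a : ℚ⟮θ⟯) ^ (n * n - (i.modNat : ℕ) * s r) *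
        ((twVal W i.divNat i.modNat (t r) (s r) : ℚ⟮θ⟯) *
          ((a : ℚ⟮θ⟯) * g) ^ ((i.modNat : ℕ) * s r)) := by
      simp only [hX, Matrix.of_apply]
      rw [← Nat.sub_add_cancel (hks i r), pow_add, mul_pow, Nat.add_sub_cancel]
      ring
    have hi : ∀ z : ℤ, IsIntegral ℤ (z : ℚ⟮θ⟯) := fun z => by
      simpa using isIntegral_algebraMap (R := ℤ) (A := ℚ⟮θ⟯) (x := z)
    rw [h1]
    exact ((hi a).pow _).mul ((hi _).mul (haint.pow _))
  have hXφ : ∀ φ : ℚ⟮θ⟯ →+* ℂ, ‖φ X.det‖ ≤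
      (((J + 1) * n).factorial : ℝ) * H₂ ^ ((J + 1) * n) := fun φ => by
    have h1 : ∀ i r, NormedField.toAbsoluteValue ℂ (φ.mapMatrix X i r) ≤ H₂ := fun i r => by
      have h2 : ‖φ g‖ ≤ max 1 H₁ := (hH₁ (Set.mem_range_self φ)).trans (le_max_right _ _)
      have h3 : |(twVal W i.divNat i.modNat (t r) (s r) : ℝ)| ≤
          (J + n * W : ℝ) ^ T * (n : ℝ) ^ J := by
        exact_mod_cast abs_twVal_le hn hW (Nat.lt_succ_iff.1 i.divNat.2) i.modNat.2.le
          (ht r).le (hs r).le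
      change ‖φ (X i r)‖ ≤ H₂
      simp only [hX, Matrix.of_apply, map_mul, map_pow, map_intCast, norm_mul, norm_pow,
        Complex.norm_intCast]
      calc |(a : ℝ)| ^ (n * n) * (|(twVal W i.divNat i.modNat (t r) (s r) : ℝ)| *
            ‖φ g‖ ^ ((i.modNat : ℕ) * s r))
          ≤ |(a : ℝ)| ^ (n * n) * (((J + n * W : ℝ) ^ T * (n : ℝ) ^ J) *
            max 1 H₁ ^ (n * n)) := by
            refine mul_le_mul_of_nonneg_left (mul_le_mul h3 ?_ (by positivity) (by positivity))
              (by positivity)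
            exact (pow_le_pow_left₀ (norm_nonneg _) h2 _).trans
              (pow_le_pow_right₀ (le_max_left _ _) (hks i r))
        _ = H₂ := by rw [hH₂, mul_pow]; ring
    have h4 := Matrix.det_le h1
    rw [Fintype.card_fin, nsmul_eq_mul, ← RingHom.map_det] at h4
    exact h4
  have hn1 : (1 : ℝ) ≤ n := by exact_mod_cast hn
  have hJW : (1 : ℝ) ≤ J + n * W := by
    have : (1 : ℝ) ≤ n * W := by exact_mod_cast Nat.mul_pos hn hW
    have : (0 : ℝ) ≤ J := Nat.cast_nonneg _
    linarith
  have hH₂1 : 1 ≤ H₂ := one_le_mul_of_one_le_of_one_le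
    (one_le_mul_of_one_le_of_one_le (one_le_pow₀ hJW) (one_le_pow₀ hn1))
    (one_le_pow₀ (one_le_mul_of_one_le_of_one_le ha1 (le_max_left _ _)))
  have hfac : (1 : ℝ) ≤ ((J + 1) * n).factorial := by exact_mod_cast ((J + 1) * n).factorial_pos
  have hmain := one_le_norm_mul_of_isIntegral (algebraMap ℚ⟮θ⟯ ℚ_[p]) hX0 hXint hXφ
  rw [max_eq_left (one_le_mul_of_one_le_of_one_le hfac (one_le_pow₀ hH₂1)), hιX, norm_mul,
    norm_pow, norm_pow] at hmain
  have ha2 : (‖(a : ℚ_[p])‖ ^ (n * n)) ^ ((J + 1) * n) ≤ 1 :=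
    pow_le_one₀ (by positivity) (pow_le_one₀ (norm_nonneg _) (Padic.norm_int_le_one a))
  refine hmain.trans ?_
  rw [mul_assoc ‖Δ‖]
  refine mul_le_mul_of_nonneg_right (mul_le_of_le_one_left (norm_nonneg _) ha2) (by positivity)

theorem exists_nat_log_lt {δ : ℝ} (hδ : 0 < δ) (A B : ℝ) :
    ∃ n : ℕ, 1 ≤ n ∧ -δ * n + A * Real.log n + B < 0 := by
  have h1 := (Real.isLittleO_log_id_atTop.const_mul_left A).bound (half_pos hδ)
  have h2 := (tendsto_natCast_atTop_atTop (R := ℝ)).eventually h1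
  have h3 := (tendsto_natCast_atTop_atTop (R := ℝ)).eventually_gt_atTop (2 * B / δ)
  obtain ⟨n, ⟨h4, h5⟩, h6⟩ := ((h2.and h3).and (eventually_ge_atTop 1)).exists
  refine ⟨n, h6, ?_⟩
  rw [id, Real.norm_eq_abs, Real.norm_eq_abs, abs_of_nonneg (Nat.cast_nonneg n : (0 : ℝ) ≤ n)] at h4
  rw [div_lt_iff₀ hδ] at h5
  have := le_abs_self (A * Real.log n)
  linarith

end Transcendence

/-! ### Choice of parameters, and transcendence of `exp W`. -/

section Mahler

variable {p}

/-- The comparison of the upper and lower bounds for determinants, after taking logarithms. -/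
theorem exists_parameters {u h lc : ℝ} (hu : 0 < u) (hlc : 0 ≤ lc) (d : ℕ) {W : ℕ} (hW : 1 ≤ W) :
    ∃ C n : ℕ, 1 ≤ n ∧
      (((C * n + 1) * n : ℕ) : ℝ) * (-u * ((((C * n + 1) * n : ℕ) : ℝ) - 1) / 2 + u * (C * n : ℕ) +
        d * (Real.log ((C * n + 1) * n : ℕ) + ((C * n + n : ℕ) : ℝ) *
          Real.log ((C * n : ℕ) + n * W) + (C * n : ℕ) * Real.log n + (n * n : ℕ) * h)) + lc < 0 := by
  -- With `J = C n` and `L = (C n + 1) n`, the gain per row is about `u C n² / 2` and the only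
  -- competing term of order `n²` is `d h n²`. This `C` leaves a margin `n²`, which beats the
  -- remaining `O(n log n)` for large `n`.
  obtain ⟨C, hC⟩ := exists_nat_gt ((d * h + 1) / (u / 2))
  rw [div_lt_iff₀ (half_pos hu)] at hC
  obtain ⟨n, hn, hlt⟩ := exists_nat_log_lt one_pos (d * (2 * C + 3))
    (u * C + d * (Real.log (C + 1) + (C + 1) * Real.log (C + W)) + lc)
  refine ⟨C, n, hn, ?_⟩
  have hn1 : (1 : ℝ) ≤ n := by exact_mod_cast hn
  have hn0 : (0 : ℝ) < n := one_pos.trans_le hn1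
  have hC0 : (0 : ℝ) ≤ C := Nat.cast_nonneg C
  have hd0 : (0 : ℝ) ≤ d := Nat.cast_nonneg d
  have hW1 : (1 : ℝ) ≤ W := by exact_mod_cast hW
  have hlogn : 0 ≤ Real.log n := Real.log_nonneg hn1
  have hlogC : 0 ≤ Real.log (C + 1 : ℝ) := Real.log_nonneg (by linarith)
  have hL : (((C * n + 1) * n : ℕ) : ℝ) = (C * n + 1) * n := by push_cast; ring
  have hL1 : (1 : ℝ) ≤ (C * n + 1) * n :=
    one_le_mul_of_one_le_of_one_le (by linarith [mul_nonneg hC0 hn0.le]) hn1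
  have hlogL : Real.log ((C * n + 1) * n : ℝ) ≤ n * (Real.log (C + 1) + 2 * Real.log n) := by
    have h1 : ((C * n + 1) * n : ℝ) ≤ (C + 1) * (n * n) := by nlinarith
    calc Real.log ((C * n + 1) * n : ℝ) ≤ Real.log ((C + 1) * (n * n)) :=
          Real.log_le_log (by linarith) h1
      _ = 1 * (Real.log (C + 1) + 2 * Real.log n) := by
          rw [Real.log_mul (by positivity) (by positivity), Real.log_mul hn0.ne' hn0.ne']
          ring
      _ ≤ _ := mul_le_mul_of_nonneg_right hn1 (by positivity)
  have hlogJ : Real.log ((C * n : ℝ) + n * W) = Real.log n + Real.log (C + W) := by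
    rw [← Real.log_mul hn0.ne' (by positivity)]
    congr 1
    ring
  rw [hL]
  push_cast
  rw [hlogJ]
  set b : ℝ := -u * ((C * n + 1) * n - 1) / 2 + u * (C * n) +
    d * (Real.log ((C * n + 1) * n) + (C * n + n) * (Real.log n + Real.log (C + W)) +
      C * n * Real.log n + n * n * h) with hb
  have hb1 : b ≤ n * (-1 * n + d * (2 * C + 3) * Real.log n +
      (u * C + d * (Real.log (C + 1) + (C + 1) * Real.log (C + W)))) := by
    have h1 : -u * ((C * n + 1) * n - 1) / 2 ≤ -(C * (u / 2)) * (n * n) := by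
      have : u * (n - 1) ≥ 0 := mul_nonneg hu.le (by linarith)
      linarith
    have h2 : (d * h + 1) * (n * n) ≤ C * (u / 2) * (n * n) :=
      mul_le_mul_of_nonneg_right hC.le (by positivity)
    have h3 := mul_le_mul_of_nonneg_left hlogL hd0
    rw [hb]
    linarith
  have hb2 : b < -lc := by
    have h4 : n * (-1 * n + d * (2 * C + 3) * Real.log n +
        (u * C + d * (Real.log (C + 1) + (C + 1) * Real.log (C + W)))) < n * -lc :=
      mul_lt_mul_of_pos_left (by linarith) hn0
    have h5 : (n : ℝ) * -lc ≤ -lc := by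
      have := mul_le_mul_of_nonneg_right hn1 hlc
      linarith
    linarith
  have hb3 : ((C * n + 1) * n : ℝ) * b ≤ b := by
    have := mul_le_mul_of_nonpos_right hL1 (show b ≤ 0 by linarith)
    linarith
  linarith

/-- Mahler's theorem on the `p`-adic exponential, for positive integers in the disc of
convergence. -/
theorem transcendental_exp_natCast {W : ℕ} (hW : 1 ≤ W) (hw : ‖(W : ℚ_[p])‖ * rho p < 1) :
    Transcendental ℚ (NormedSpace.exp (W : ℚ_[p])) := by
  intro halg
  obtain ⟨d, c, H, hc, hH, hlow⟩ := exists_lower_bound hW halg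
  have hw0 : (W : ℚ_[p]) ≠ 0 := Nat.cast_ne_zero.2 (by omega)
  set η := ‖(W : ℚ_[p])‖ * rho p with hη
  have hη0 : 0 < η := mul_pos (norm_pos_iff.2 hw0) (rho_pos p)
  have hu : 0 < -Real.log η := neg_pos.2 (Real.log_neg hη0 hw)
  obtain ⟨C, n, hn, hlt⟩ := exists_parameters hu (Real.log_nonneg hc) d hW (h := Real.log H)
  -- `T = J + n` gives `T + 1 - n = J + 1 > J`, just enough for the zero estimate.
  obtain ⟨s, t, hs, ht, hdet⟩ := exists_det_expVal_ne_zero hw0 (exp_ne_zero_of_lt hw)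
    (n := n) (J := C * n) (T := C * n + n)
    (Nat.mul_lt_mul_of_pos_left (show C * n < C * n + n + 1 - n by omega) hn)
  have hl := hlow n (C * n) (C * n + n) s t hn hs ht hdet
  have hup := norm_det_expVal_le hw0 hw (n := n) (J := C * n) s t
  rw [← hη] at hup
  set L := (C * n + 1) * n with hL
  set Q : ℝ := (((C * n : ℕ) : ℝ) + n * W) ^ (C * n + n) * (n : ℝ) ^ (C * n) * H ^ (n * n) with hQ
  have hn0 : (0 : ℝ) < n := by exact_mod_cast hn
  have hJW : (0 : ℝ) < ((C * n : ℕ) : ℝ) + n * W := by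
    have : (0 : ℝ) < n * W := by exact_mod_cast Nat.mul_pos hn hW
    positivity
  have hH0 : 0 < H := one_pos.trans_le hH
  have hc0 : 0 < c := one_pos.trans_le hc
  have hQ0 : 0 < Q := by positivity
  have hL0 : 0 < L := Nat.mul_pos (Nat.succ_pos _) hn
  have hfac0 : (0 : ℝ) < L.factorial := by exact_mod_cast L.factorial_pos
  have hone : 1 ≤ η ^ (∑ i ∈ Finset.range L, i) / (η ^ (C * n)) ^ L *
      ((L.factorial : ℝ) * Q ^ L) ^ d * c :=
    hl.trans (mul_le_mul_of_nonneg_right (mul_le_mul_of_nonneg_right hup (by positivity)) hc0.le)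
  have hlogQ : Real.log Q = ((C * n + n : ℕ) : ℝ) * Real.log (((C * n : ℕ) : ℝ) + n * W) +
      ((C * n : ℕ) : ℝ) * Real.log n + ((n * n : ℕ) : ℝ) * Real.log H := by
    rw [hQ, Real.log_mul (mul_pos (pow_pos hJW _) (pow_pos hn0 _)).ne' (pow_pos hH0 _).ne',
      Real.log_mul (pow_pos hJW _).ne' (pow_pos hn0 _).ne', Real.log_pow, Real.log_pow,
      Real.log_pow]
  have hlog := Real.log_nonneg hone
  clear_value η Q
  rw [Real.log_mul (by positivity) hc0.ne', Real.log_mul (by positivity) (by positivity),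
    Real.log_div (by positivity) (by positivity), Real.log_pow, Real.log_pow, Real.log_pow,
    Real.log_pow, Real.log_mul hfac0.ne' (by positivity), Real.log_pow, hlogQ] at hlog
  have hsum : ((∑ i ∈ Finset.range L, i : ℕ) : ℝ) = L * (L - 1) / 2 := by
    have h1 := Finset.sum_range_id_mul_two L
    have h2 : ((∑ i ∈ Finset.range L, i : ℕ) : ℝ) * 2 = L * (L - 1) := by
      rw [← Nat.cast_pred hL0]
      exact_mod_cast h1
    linarith
  have hfac : Real.log L.factorial ≤ L * Real.log L := by
    rw [← Real.log_pow]
    exact Real.log_le_log hfac0 (by exact_mod_cast L.factorial_le_pow)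
  have hfac' := mul_le_mul_of_nonneg_left hfac (Nat.cast_nonneg (α := ℝ) d)
  rw [hsum] at hlog
  linarith

end Mahler

/-! ### Closed form of `Γ(m + 1, r)`. -/

section IncompleteGamma

/-- The sum `∑ k ≤ m, m! / k! * x ^ k`. -/
def incSum {R : Type*} [Field R] (m : ℕ) (x : R) : R :=
  ∑ k ∈ Finset.range (m + 1), (m.factorial : R) / (k.factorial : R) * x ^ k

theorem incSum_succ {R : Type*} [Field R] [CharZero R] (m : ℕ) (x : R) :
    incSum (m + 1) x = (m + 1) * incSum m x + x ^ (m + 1) := by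
  have h : ((m + 1).factorial : R) ≠ 0 := Nat.cast_ne_zero.2 (Nat.factorial_ne_zero _)
  rw [incSum, Finset.sum_range_succ, div_self h, one_mul, incSum, Finset.mul_sum,
    Nat.factorial_succ]
  push_cast
  congr 1
  exact Finset.sum_congr rfl fun k _ => by ring

theorem map_incSum {R R' : Type*} [Field R] [Field R'] (f : R →+* R') (m : ℕ) (x : R) :
    f (incSum m x) = incSum m (f x) := by
  simp [incSum]

theorem hasDerivAt_incSum (m : ℕ) (x : ℝ) :
    HasDerivAt (fun t : ℝ => incSum m t) (incSum m x - x ^ m) x := by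
  induction m with
  | zero => simpa [incSum] using hasDerivAt_const x (1 : ℝ)
  | succ m ih =>
    have h1 := (ih.const_mul ((m : ℝ) + 1)).add (hasDerivAt_pow (m + 1) x)
    have h2 : (fun t : ℝ => incSum (m + 1) t) =
        (fun t : ℝ => ((m : ℝ) + 1) * incSum m t) + fun t => t ^ (m + 1) :=
      funext fun t => incSum_succ m t
    rw [h2]
    refine h1.congr_deriv ?_
    rw [incSum_succ]
    push_cast
    ring

theorem hasDerivAt_neg_incSum_mul_exp (m : ℕ) (x : ℝ) :
    HasDerivAt (fun t : ℝ => -(incSum m t * Real.exp (-t))) (x ^ m * Real.exp (-x)) x := by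
  have h1 : HasDerivAt (fun t : ℝ => Real.exp (-t)) (Real.exp (-x) * -1) x :=
    (hasDerivAt_neg x).exp
  refine ((hasDerivAt_incSum m x).mul h1).neg.congr_deriv ?_
  ring

theorem tendsto_incSum_mul_exp (m : ℕ) :
    Tendsto (fun t : ℝ => -(incSum m t * Real.exp (-t))) atTop (𝓝 0) := by
  have h : Tendsto (fun t : ℝ => ∑ k ∈ Finset.range (m + 1),
      (m.factorial : ℝ) / (k.factorial : ℝ) * (t ^ k * Real.exp (-t))) atTop
      (𝓝 (∑ k ∈ Finset.range (m + 1), (m.factorial : ℝ) / (k.factorial : ℝ) * 0)) :=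
    tendsto_finsetSum _ fun k _ =>
      (Real.tendsto_pow_mul_exp_neg_atTop_nhds_zero k).const_mul _
  have h2 : (fun t : ℝ => -(incSum m t * Real.exp (-t))) = fun t : ℝ =>
      -∑ k ∈ Finset.range (m + 1),
        (m.factorial : ℝ) / (k.factorial : ℝ) * (t ^ k * Real.exp (-t)) := by
    funext t
    rw [incSum, Finset.sum_mul]
    simp_rw [mul_assoc]
  rw [h2]
  simpa using h.neg

theorem integrableOn_pow_mul_exp_neg (m : ℕ) (r : ℝ) :
    IntegrableOn (fun t : ℝ => t ^ m * Real.exp (-t)) (Set.Ioi r) := by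
  refine integrable_of_isBigO_exp_neg (b := 1 / 2) (by norm_num) (by fun_prop) ?_
  have h1 := (isLittleO_pow_exp_pos_mul_atTop m (b := 1 / 2) (by norm_num)).isBigO
  have h2 := h1.mul (Asymptotics.isBigO_refl (fun t : ℝ => Real.exp (-t)) atTop)
  refine h2.congr_right fun t => ?_
  rw [← Real.exp_add]
  congr 1
  ring

/-- The integrand has antiderivative `-incSum m t * exp (-t)`, because `incSum m` minus its
derivative is `t^m`; it tends to `0` at infinity. -/
theorem incompleteGamma_succ (m : ℕ) (r : ℝ) :
    incompleteGamma ((m + 1 : ℕ) : ℂ) r = ((incSum m r * Real.exp (-r) : ℝ) : ℂ) := by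
  have h1 : ∀ t : ℝ, (t : ℂ) ^ (((m + 1 : ℕ) : ℂ) - 1) * Complex.exp (-(t : ℂ)) =
      ((t ^ m * Real.exp (-t) : ℝ) : ℂ) := fun t => by
    rw [Nat.cast_succ, add_sub_cancel_right, Complex.cpow_natCast]
    push_cast
    rfl
  have h2 := integral_Ioi_of_hasDerivAt_of_tendsto' (a := r)
    (fun x _ => hasDerivAt_neg_incSum_mul_exp m x) (integrableOn_pow_mul_exp_neg m r)
    (tendsto_incSum_mul_exp m)
  rw [incompleteGamma]
  simp_rw [h1]
  rw [integral_complex_ofReal, h2]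
  simp

theorem incompleteGamma_succ_eq_coe (m : ℕ) (r : ℤ) :
    incompleteGamma ((m + 1 : ℕ) : ℂ) (r : ℝ) = ((incSum m (r : Qe) * eGen⁻¹ ^ r : Qe) : ℂ) := by
  have h1 : ((incSum m (r : Qe) : Qe) : ℂ) = incSum m (r : ℂ) := by
    have := map_incSum (algebraMap Qe ℂ) m (r : Qe)
    rwa [map_intCast] at this
  have h2 : ((incSum m (r : ℝ) : ℝ) : ℂ) = incSum m (r : ℂ) := by
    have := map_incSum Complex.ofRealHom m (r : ℝ)
    rwa [map_intCast] at this
  have h3 : (eGen : ℂ) = Complex.exp 1 := IntermediateField.AdjoinSimple.coe_gen ℚ _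
  have h4 : ((eGen⁻¹ ^ r : Qe) : ℂ) = (Complex.exp 1)⁻¹ ^ r := by
    have := map_zpow₀ (algebraMap Qe ℂ) eGen⁻¹ r
    rw [map_inv₀] at this
    rw [← h3]
    exact this
  rw [incompleteGamma_succ, MulMemClass.coe_mul, h1, Complex.ofReal_mul, h2, h4]
  congr 1
  rw [← Complex.exp_neg, ← Complex.exp_int_mul]
  push_cast
  congr 1
  ring

end IncompleteGamma

/-! ### The field homomorphism `τ_p`, interpolation and uniqueness. -/

section FieldMap

theorem transcendental_rat_exp_one : Transcendental ℚ (Complex.exp 1) := fun h =>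
  transcendental_exp_one ((IsFractionRing.isAlgebraic_iff ℤ ℚ ℂ).2 h)

theorem one_le_pTilde : 1 ≤ pTilde p := by
  have := (Fact.out : p.Prime).one_lt
  rw [pTilde]
  split_ifs <;> omega

theorem transcendental_exp_pTilde :
    Transcendental ℚ (NormedSpace.exp (pTilde p : ℚ_[p])) :=
  transcendental_exp_natCast (one_le_pTilde p) (norm_pTilde_mul_rho_lt_one p)

-- Both simple extensions are isomorphic to the rational function field `K(X)`, with the generators
-- corresponding to `X`.
open IntermediateField in
theorem exists_ringHom_adjoin_of_transcendental {K A B : Type*} [Field K] [Field A] [Algebra K A]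
    [Field B] [Algebra K B] {a : A} {b : B} (ha : Transcendental K a) (hb : Transcendental K b) :
    ∃ τ : K⟮a⟯ →+* B, τ (AdjoinSimple.gen K a) = b :=
  ⟨(algebraMap K⟮b⟯ B).comp ((RatFunc.algEquivOfTranscendental b hb).toRingEquiv.toRingHom.comp
    (RatFunc.algEquivOfTranscendental a ha).symm.toRingEquiv.toRingHom), by simp⟩

theorem exists_ringHom_eGen : ∃ τ : Qe →+* ℚ_[p],
    τ eGen⁻¹ = NormedSpace.exp (pTilde p : ℚ_[p]) := by
  obtain ⟨τ, hτ⟩ := exists_ringHom_adjoin_of_transcendental transcendental_rat_exp_one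
    (b := (NormedSpace.exp (pTilde p : ℚ_[p]))⁻¹)
    fun h => transcendental_exp_pTilde p (IsAlgebraic.inv_iff.1 h)
  exact ⟨τ, by rw [map_inv₀, hτ, inv_inv]⟩

/-- Every element of `ℚ(e)` is a quotient of polynomials in `e` with rational coefficients, and a
ring homomorphism is forced on `ℚ`. -/
theorem ringHom_Qe_ext {R : Type*} [Field R] [CharZero R] {σ τ : Qe →+* R}
    (h : σ eGen = τ eGen) : σ = τ := by
  ext x
  obtain ⟨P, Q, hx⟩ := (IntermediateField.mem_adjoin_simple_iff ℚ (x : ℂ)).1 x.2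
  have h1 : x = Polynomial.aeval eGen P / Polynomial.aeval eGen Q := by
    apply Subtype.ext
    have h2 : ∀ P : Polynomial ℚ, ((Polynomial.aeval eGen P : Qe) : ℂ) =
        Polynomial.aeval (Complex.exp 1) P := fun P =>
      (Polynomial.aeval_algebraMap_apply ℂ eGen P).symm
    rw [hx, IntermediateField.coe_div, h2, h2]
  have h3 : ∀ (σ : Qe →+* R) (P : Polynomial ℚ),
      σ (Polynomial.aeval eGen P) = P.eval₂ (algebraMap ℚ R) (σ eGen) := fun σ P => by
    rw [Polynomial.aeval_def, Polynomial.hom_eval₂]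
    congr 1
    exact RingHom.ext_rat _ _
  rw [h1, map_div₀, map_div₀, h3, h3, h3, h3, h]

theorem norm_intCast_sub_one_lt {r : ℤ} (hr : r ≡ 1 [ZMOD p]) : ‖(r : ℂ_[p]) - 1‖ < 1 := by
  have h1 : (r : ℂ_[p]) - 1 = algebraMap ℚ_[p] ℂ_[p] ((r - 1 : ℤ) : ℚ_[p]) := by
    rw [map_intCast]
    push_cast
    rfl
  rw [h1, norm_algebraMap', Padic.norm_intCast_lt_one_iff]
  exact hr.symm.dvd

theorem exp_intCast_mul_pTilde (r : ℤ) :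
    NormedSpace.exp ((r : ℂ_[p]) * (pTilde p : ℂ_[p])) =
      algebraMap ℚ_[p] ℂ_[p] (NormedSpace.exp (pTilde p : ℚ_[p]) ^ r) := by
  have hw := norm_pTilde_mul_rho_lt_one p
  have hrw : ‖(r : ℚ_[p]) * (pTilde p : ℚ_[p])‖ * rho p < 1 := by
    refine lt_of_le_of_lt (mul_le_mul_of_nonneg_right ?_ (rho_pos p).le) hw
    rw [norm_mul]
    exact mul_le_of_le_one_left (norm_nonneg _) (Padic.norm_int_le_one r)
  rw [← exp_intCast_mul hw, algebraMap_exp hrw, map_mul, map_intCast, map_natCast]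

variable {p} in
theorem gammaBar_natCast_succ (τ : Qe →+* ℚ_[p])
    (hτ : τ eGen⁻¹ = NormedSpace.exp (pTilde p : ℚ_[p])) {r : ℤ} (hr : r ≡ 1 [ZMOD p]) (m : ℕ) :
    gammaBar p (r : ℂ_[p]) ((m + 1 : ℕ) : ℤ_[p]) =
      algebraMap ℚ_[p] ℂ_[p] (τ (incSum m (r : Qe) * eGen⁻¹ ^ r)) := by
  have h : τ (incSum m (r : Qe) * eGen⁻¹ ^ r) =
      incSum m (r : ℚ_[p]) * NormedSpace.exp (pTilde p : ℚ_[p]) ^ r := by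
    rw [map_mul, map_incSum, map_intCast, map_zpow₀, hτ]
  rw [gammaBar, Nat.cast_succ, add_sub_cancel_right,
    SInv_powFun_natCast (norm_intCast_sub_one_lt p hr), exp_intCast_mul_pTilde, h, map_mul,
    map_incSum, map_intCast, mul_comm]
  rfl

variable {p} in
theorem exists_gammaBar_natCast_eq (τ : Qe →+* ℚ_[p])
    (hτ : τ eGen⁻¹ = NormedSpace.exp (pTilde p : ℚ_[p])) {r : ℤ} (hr : r ≡ 1 [ZMOD p]) {n : ℕ}
    (hn : 1 ≤ n) : ∃ h : incompleteGamma (n : ℂ) (r : ℝ) ∈ Qe,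
      gammaBar p (r : ℂ_[p]) (n : ℤ_[p]) =
        algebraMap ℚ_[p] ℂ_[p] (τ ⟨incompleteGamma (n : ℂ) (r : ℝ), h⟩) := by
  obtain ⟨m, rfl⟩ := Nat.exists_eq_add_of_le' hn
  have h := incompleteGamma_succ_eq_coe m r
  have hmem : incompleteGamma ((m + 1 : ℕ) : ℂ) (r : ℝ) ∈ Qe := by
    rw [h]
    exact SetLike.coe_mem _
  refine ⟨hmem, ?_⟩
  rw [gammaBar_natCast_succ τ hτ hr]
  congr 2
  exact Subtype.ext h.symm

variable {p} in
theorem eq_of_forall_natCast {f g : ℤ_[p] → ℂ_[p]} (hf : Continuous f) (hg : Continuous g)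
    (h : ∀ n : ℕ, 1 ≤ n → f n = g n) : f = g := by
  -- Translating by `1` reduces equality at positive integers to density of all of `ℕ`.
  have h1 := PadicInt.denseRange_natCast (p := p) |>.equalizer
    (hf.comp (continuous_add_const (1 : ℤ_[p]))) (hg.comp (continuous_add_const (1 : ℤ_[p])))
    (funext fun n => by simpa using h (n + 1) (Nat.le_add_left 1 n))
  funext x
  simpa using congrFun h1 (x - 1)

end FieldMap

end PadicIncGamma

theorem mainTheorem3 (p : ℕ) [Fact p.Prime] :
    -- the map `S` is invertible
    Function.Bijective (PadicIncGamma.S p) ∧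
    -- for all `r` in the open unit ball around `1` in `ℂ_[p]`
    (∀ r : ℂ_[p], ‖r - 1‖ < 1 →
      -- local analyticity
      PadicIncGamma.IsLocallyAnalytic (PadicIncGamma.gammaBar p r) ∧
      -- the Mahler series of `x ↦ γ̄_r(x + 1)`
      (Filter.Tendsto (fun n : ℕ => NormedSpace.exp (r * (PadicIncGamma.pTilde p : ℂ_[p])) *
          ∑ k ∈ Finset.range (n + 1), (n.factorial : ℂ_[p]) / (k.factorial : ℂ_[p]) * (r - 1) ^ k)
        Filter.atTop (nhds 0) ∧
       ∀ x : ℤ_[p], HasSum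
        (fun n : ℕ => (NormedSpace.exp (r * (PadicIncGamma.pTilde p : ℂ_[p])) *
          ∑ k ∈ Finset.range (n + 1), (n.factorial : ℂ_[p]) / (k.factorial : ℂ_[p]) * (r - 1) ^ k) *
            PadicIncGamma.toCp p (Ring.choose x n))
        (PadicIncGamma.gammaBar p r (x + 1))) ∧
      -- the explicit expansions
      (∀ x : ℤ_[p],
        Summable (fun n : ℕ => PadicIncGamma.toCp p ((descPochhammer ℤ_[p] n).eval (x - 1)) *
          PadicIncGamma.powFun p r (x - 1 - n)) ∧
        PadicIncGamma.gammaBar p r x = NormedSpace.exp (r * (PadicIncGamma.pTilde p : ℂ_[p])) *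
          ∑' n : ℕ, PadicIncGamma.toCp p ((descPochhammer ℤ_[p] n).eval (x - 1)) *
            PadicIncGamma.powFun p r (x - 1 - n) ∧
        PadicIncGamma.gammaBar p r x = NormedSpace.exp (r * (PadicIncGamma.pTilde p : ℂ_[p])) *
          ∑' n : ℕ, (n.factorial : ℂ_[p]) * PadicIncGamma.toCp p (Ring.choose (x - 1) n) *
            PadicIncGamma.powFun p r (x - 1 - n))) ∧
    -- the field map `τ_p`, and interpolation
    ∃ τ : PadicIncGamma.Qe →+* ℚ_[p],
      τ PadicIncGamma.eGen⁻¹ = NormedSpace.exp (PadicIncGamma.pTilde p : ℚ_[p]) ∧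
      (∀ σ : PadicIncGamma.Qe →+* ℚ_[p],
        σ PadicIncGamma.eGen⁻¹ = NormedSpace.exp (PadicIncGamma.pTilde p : ℚ_[p]) → σ = τ) ∧
      ∀ r : ℤ, r ≡ 1 [ZMOD p] →
        (∀ n : ℕ, 1 ≤ n → ∃ h : PadicIncGamma.incompleteGamma (n : ℂ) (r : ℝ) ∈ PadicIncGamma.Qe,
          PadicIncGamma.gammaBar p (r : ℂ_[p]) (n : ℤ_[p]) =
            algebraMap ℚ_[p] ℂ_[p]
              (τ ⟨PadicIncGamma.incompleteGamma (n : ℂ) (r : ℝ), h⟩)) ∧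
        -- `γ̄_r` is the only continuous function that interpolates these values
        (∀ f : ℤ_[p] → ℂ_[p], Continuous f →
          (∀ n : ℕ, 1 ≤ n →
            ∃ h : PadicIncGamma.incompleteGamma (n : ℂ) (r : ℝ) ∈ PadicIncGamma.Qe,
              f (n : ℤ_[p]) = algebraMap ℚ_[p] ℂ_[p]
                (τ ⟨PadicIncGamma.incompleteGamma (n : ℂ) (r : ℝ), h⟩)) →
          f = PadicIncGamma.gammaBar p (r : ℂ_[p])) := by
  refine ⟨PadicIncGamma.S_bijective p, fun r hr => ⟨PadicIncGamma.isLocallyAnalytic_gammaBar hr,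
    ⟨?_, fun x => PadicIncGamma.hasSum_gammaBar_mahler hr x⟩, fun x => ?_⟩, ?_⟩
  · have h := (PadicIncGamma.tendsto_mahlerCoeff hr).const_mul
      (NormedSpace.exp (r * (PadicIncGamma.pTilde p : ℂ_[p])))
    rw [mul_zero] at h
    exact h
  · have h := PadicIncGamma.hasSum_SInv (PadicIncGamma.powFun p r) (x - 1)
    refine ⟨h.summable, ?_, ?_⟩
    · rw [h.tsum_eq]
      rfl
    · have h2 : ∀ n : ℕ, (n.factorial : ℂ_[p]) * PadicIncGamma.toCp p (Ring.choose (x - 1) n) =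
          PadicIncGamma.toCp p ((descPochhammer ℤ_[p] n).eval (x - 1)) := fun n => by
        rw [← PadicIncGamma.factorial_mul_choose, map_mul, map_natCast]
      simp_rw [h2]
      rw [h.tsum_eq]
      rfl
  · obtain ⟨τ, hτ⟩ := PadicIncGamma.exists_ringHom_eGen p
    refine ⟨τ, hτ, fun σ hσ => ?_, fun r hr =>
      ⟨fun n hn => PadicIncGamma.exists_gammaBar_natCast_eq τ hτ hr hn, fun f hf hfn => ?_⟩⟩
    · refine PadicIncGamma.ringHom_Qe_ext (inv_injective ?_)
      rw [← map_inv₀, ← map_inv₀, hσ, hτ]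
    · refine PadicIncGamma.eq_of_forall_natCast hf
        (PadicIncGamma.continuous_gammaBar _) fun n hn => ?_
      obtain ⟨h₁, h₁'⟩ := hfn n hn
      obtain ⟨h₂, h₂'⟩ := PadicIncGamma.exists_gammaBar_natCast_eq τ hτ hr hn
      rw [h₁', h₂']
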